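/- Let $d\ge 1$ be a fixed integer. Let $X_1,\dots,X_n$ be independent uniformly random points of $[0,1]^d$ and, independently of them, let $G_{n,p}$ be the random graph on $[n]=\{1,\dots,n\}$ in which each pair of vertices is joined by an edge independently with probability $p=p(n)\in[0,1]$. Give each edge $ij$ the length $|X_i-X_j|$ (Euclidean distance). For vertices $u,v\in[n]$ let $\mathrm{dist}(u,v)$ be the minimum total length of a path from $u$ to $v$ in this graph ($\infty$ if there is no such path). A sequence of events $\mathcal E_n$ holds asymptotically almost surely (a.a.s.) if $\lim_{n\to\infty}\Pr(\neg\mathcal E_n)=0$. Let $\omega=\omega(n)\to\infty$. (a) If $$p\le \frac{1}{\omega^d(\log\log n)^{2d}}\cdot\frac{\log^d n}{n}$$ for all sufficiently large $n$, then for any fixed (non-random, possibly depending on $n$) distinct vertices $u,v\in[n]$, a.a.s. $$\mathrm{dist}(u,v)\ge \frac{\omega}{8de^d}.$$ (b) If $$p\ge \frac{\omega\log^d n}{n}$$ for all sufficiently large $n$, then a.a.s., uniformly for all vertices $u,v$, $\mathrm{dist}(u,v)=|X_u-X_v|+o(1)$; that is, there is a deterministic sequence $\varepsilon_n\to 0$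 such that a.a.s. for all $u,v\in[n]$, $\mathrm{dist}(u,v)$ is finite and $\bigl|\mathrm{dist}(u,v)-|X_u-X_v|\bigr|\le\varepsilon_n$. -/

import Mathlib

open Filter Topology MeasureTheory

namespace EmbeddedRandomGraph

/-- The cube `[0,1]^d` in Euclidean `d`-space. -/
def cube (d : ℕ) : Set (EuclideanSpace ℝ (Fin d)) :=
  {x | ∀ i, x i ∈ Set.Icc (0 : ℝ) 1}

/-- The uniform distribution on the cube: Lebesgue measure restricted to a set of volume one. -/
noncomputable def uniformCube (d : ℕ) : Measure (EuclideanSpace ℝ (Fin d)) :=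
  volume.restrict (cube d)

/-- An outcome: a position for each of the `n` vertices, and a graph on the `n` vertices. -/
abbrev Outcome (d n : ℕ) : Type :=
  (Fin n → EuclideanSpace ℝ (Fin d)) × SimpleGraph (Fin n)

/-- The law of the randomly embedded random graph: the positions are independent and uniform in
the cube, and the graph is the binomial random graph, independent of the positions. -/
noncomputable def law (d n : ℕ) (p : unitInterval) : Measure (Outcome d n) :=
  (Measure.pi fun _ : Fin n => uniformCube d).prod (SimpleGraph.binomialRandom (Fin n) p)

/-- The total Euclidean length of the edges traversed by a walk. -/
noncomputable def walkLength {d n : ℕ} (x : Outcome d n) {u v : Fin n} (w : x.2.Walk u v) : ℝ :=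
  (w.darts.map fun e => dist (x.1 e.fst) (x.1 e.snd)).sum

/-- The distance in the embedded graph: the infimum of the lengths of the walks from `u` to `v`,
which is `⊤` if there is none. -/
noncomputable def graphDist {d n : ℕ} (x : Outcome d n) (u v : Fin n) : ENNReal :=
  ⨅ w : x.2.Walk u v, ENNReal.ofReal (walkLength x w)

/-- The Euclidean distance between the positions of two vertices. -/
noncomputable def euclDist {d n : ℕ} (x : Outcome d n) (u v : Fin n) : ℝ :=
  dist (x.1 u) (x.1 v)

/-- The events `E n` hold asymptotically almost surely in the graphs with edge probability
`p n`. -/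
def AAS (d : ℕ) (p : ℕ → unitInterval) (E : (n : ℕ) → Set (Outcome d n)) : Prop :=
  Tendsto (fun n => law d n (p n) (E n)ᶜ) atTop (𝓝 0)

end EmbeddedRandomGraph

namespace EmbeddedRandomGraph

/-! ### Independence of edges in the binomial random graph -/

section GraphProbabilities

open SimpleGraph unitInterval
open scoped ENNReal

variable {V : Type*} [Fintype V]

/-! Part (a) is a first moment argument. For uniform points, the expectation of `exp (-s * length)`
over a fixed path is at most `(2d/s)^d` per edge, since the path's vertices can be integrated out
one at a time. By Markov and a union bound over interior vertices, a path shorter than `L` exists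
with probability at most `exp (s L) / n` once `n p (2d/s)^d ≤ 1/2` (`law_graphDist_lt_le`). A
suitable `s` also makes `s L ≤ log n / 2`.

Part (b): fix `b`, and cut the cube into `b^d` coarse cells and each of these into `h^d` fine cells,
`h = ⌈log n⌉`. Every fine cell receives at least `m` points, with `m` of order `n / (b h)^d`
(`pi_card_filter_lt_le`). As `p m` exceeds a large constant, any two disjoint sets of about `m/5`
chosen points, each within a fine cell, are joined by an edge. This forces each fine cell to contain
a core in which small sets at least double when their neighbours are added (`Joined.exists_isCore`).
So from a core vertex one reaches more than `s ≈ m/5` others in about `log₂ n` steps of length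
`O(1/(b log n))`, at total cost `O(1/b)`.

A coarse cell has so many core vertices that every vertex in it is adjacent to one of them
(`binomialRandom_forall_not_adj_le`). To keep independence, the cores are computed in the graph with
that vertex isolated. The large balls around `u` and `v` are then joined by an edge, of length at
most `|X_u - X_v| + O(1/b)` (`graphDist_le_edist_add`). Letting `b` grow slowly gives a vanishing
error (`exists_tendsto_zero_of_forall`). -/

instance : MeasurableSingletonClass (SimpleGraph V) where
  measurableSet_singleton H := by
    rw [← (measurableEmbedding_edgeSet (V := V)).measurableSet_image, Set.image_singleton]
    exact measurableSet_singleton _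

/-- Prescribing the states of finitely many edges is an event of product form. -/
theorem binomialRandom_rectangle (p : unitInterval) (A : Finset (Sym2 V))
    (hA : ∀ e ∈ A, ¬ e.IsDiag) (t : Sym2 V → Set Prop) :
    binomialRandom V p {G | ∀ e ∈ A, (e ∈ G.edgeSet) ∈ t e} =
      ∏ e ∈ A, ((toNNReal p : ℝ≥0∞) • Measure.dirac True +
        (toNNReal (σ p) : ℝ≥0∞) • Measure.dirac False : Measure Prop) (t e) := by
  rw [binomialRandom_eq_map, Measure.map_apply (by fun_prop) (Set.toFinite _).measurableSet,
    ProbabilityTheory.setBernoulli_apply']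
  have : ((fun p : Sym2 V → Prop => {i | p i}) ⁻¹' (fromEdgeSet ⁻¹'
      {G : SimpleGraph V | ∀ e ∈ A, (e ∈ G.edgeSet) ∈ t e})) = Set.pi (A : Set (Sym2 V)) t := by
    ext f
    simp only [Set.mem_preimage, Set.mem_ofPred_eq, Set.mem_pi, Finset.mem_coe, edgeSet_fromEdgeSet]
    refine forall₂_congr fun e he => ?_
    have : (e ∈ {i | f i} \ Sym2.diagSet) = f e := by
      simp [hA e he]
    rw [this]
  rw [this, Measure.infinitePi_pi _ (fun _ _ => .of_discrete)]
  refine Finset.prod_congr rfl fun e he => ?_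
  simp [hA e he]

theorem binomialRandom_forall_mem (p : unitInterval) (A : Finset (Sym2 V))
    (hA : ∀ e ∈ A, ¬ e.IsDiag) :
    binomialRandom V p {G | ∀ e ∈ A, e ∈ G.edgeSet} = ENNReal.ofReal p ^ A.card := by
  have := binomialRandom_rectangle p A hA fun _ => {True}
  simp at this
  rw [this, ENNReal.ofReal, Real.toNNReal_of_nonneg p.2.1]
  rfl

theorem binomialRandom_forall_notMem (p : unitInterval) (A : Finset (Sym2 V))
    (hA : ∀ e ∈ A, ¬ e.IsDiag) :
    binomialRandom V p {G | ∀ e ∈ A, e ∉ G.edgeSet} = ENNReal.ofReal (1 - p) ^ A.card := by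
  have := binomialRandom_rectangle p A hA fun _ => {False}
  simp at this
  rw [this, ENNReal.ofReal, Real.toNNReal_of_nonneg (sub_nonneg.2 p.2.2)]
  rfl

variable [DecidableEq V]

/-- Independence of disjoint edge sets, in the form needed to expose the edges at one vertex last:
`A` will be the edges avoiding that vertex and `B` some of the edges at it. -/
theorem binomialRandom_inter_forall_notMem (p : unitInterval) (A B : Finset (Sym2 V))
    (hA : ∀ e ∈ A, ¬ e.IsDiag) (hB : ∀ e ∈ B, ¬ e.IsDiag) (hAB : Disjoint A B)
    (H : SimpleGraph V) :
    binomialRandom V p ({G | ∀ e ∈ A, (e ∈ G.edgeSet) = (e ∈ H.edgeSet)} ∩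
        {G | ∀ e ∈ B, e ∉ G.edgeSet}) =
      binomialRandom V p {G | ∀ e ∈ A, (e ∈ G.edgeSet) = (e ∈ H.edgeSet)} *
        ENNReal.ofReal (1 - p) ^ B.card := by
  rw [← binomialRandom_forall_notMem p B hB]
  have h1 := binomialRandom_rectangle p A hA fun e => {e ∈ H.edgeSet}
  have h2 := binomialRandom_rectangle p B hB fun _ => {False}
  have h3 := binomialRandom_rectangle p (A ∪ B)
    (fun e he => (Finset.mem_union.1 he).elim (hA e) (hB e))
    fun e => if e ∈ A then {e ∈ H.edgeSet} else {False}
  rw [Finset.prod_union hAB] at h3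
  rw [Finset.prod_congr rfl (g := fun e => ((toNNReal p : ℝ≥0∞) • Measure.dirac True +
        (toNNReal (σ p) : ℝ≥0∞) • Measure.dirac False : Measure Prop) {e ∈ H.edgeSet})
      (fun e he => by rw [if_pos he]), ← h1,
    Finset.prod_congr (s₁ := B) rfl (g := fun e => ((toNNReal p : ℝ≥0∞) • Measure.dirac True +
        (toNNReal (σ p) : ℝ≥0∞) • Measure.dirac False : Measure Prop) {False})
      (fun e he => by rw [if_neg (Finset.disjoint_right.1 hAB he)]), ← h2] at h3
  convert h3 using 2
  · ext G
    simp only [Set.mem_inter_iff, Set.mem_ofPred_eq, Finset.mem_union]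
    constructor
    · rintro ⟨ha, hb⟩ e he
      by_cases hea : e ∈ A
      · simpa [hea] using ha e hea
      · simpa [hea] using hb e (he.resolve_left hea)
    · intro h
      refine ⟨fun e he => by simpa [he] using h e (.inl he), fun e he => ?_⟩
      simpa [Finset.disjoint_right.1 hAB he] using h e (.inr he)
  · rfl
  · congr 1
    ext G
    simp

/-- The graph with all edges at `u` removed. -/
def isolate (u : V) (G : SimpleGraph V) : SimpleGraph V where
  Adj a b := G.Adj a b ∧ a ≠ u ∧ b ≠ u
  symm := ⟨fun _ _ h => ⟨h.1.symm, h.2.2, h.2.1⟩⟩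
  loopless := ⟨fun _ h => h.1.ne rfl⟩

theorem isolate_eq_iff (u : V) (G H : SimpleGraph V) :
    isolate u G = isolate u H ↔
      ∀ e ∈ (Finset.univ.filter fun e : Sym2 V => ¬ e.IsDiag ∧ u ∉ e),
        (e ∈ G.edgeSet) = (e ∈ H.edgeSet) := by
  constructor
  · intro h e
    induction e with | h a b => ?_
    intro he
    simp only [Finset.mem_filter, Finset.mem_univ, true_and, Sym2.mem_iff, not_or] at he
    have : (isolate u G).Adj a b = (isolate u H).Adj a b := by rw [h]
    simpa [isolate, Ne.symm he.2.1, Ne.symm he.2.2] using this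
  · intro h
    ext a b
    simp only [isolate]
    by_cases hab : a = b
    · subst hab; simp
    by_cases ha : a = u
    · simp [ha]
    by_cases hb : b = u
    · simp [hb]
    have := h s(a, b) (by simp [hab, Ne.symm ha, Ne.symm hb])
    simpa [ha, hb] using this

/-- A set of at least `w` vertices, chosen without looking at the edges at `u`, is missed by the
neighbourhood of `u` with probability at most `(1 - p) ^ w`. -/
theorem binomialRandom_forall_not_adj_le (p : unitInterval) (u : V) (w : ℕ)
    (W : SimpleGraph V → Finset V) (hu : ∀ G, u ∉ W G) :
    binomialRandom V p {G | w ≤ (W (isolate u G)).card ∧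
      ∀ y ∈ W (isolate u G), ¬ G.Adj u y} ≤ ENNReal.ofReal (1 - p) ^ w := by
  classical
  let μ := binomialRandom V p
  have hle : ENNReal.ofReal (1 - p) ≤ 1 := by
    rw [ENNReal.ofReal_le_one]; linarith [p.2.1]
  -- Condition on the graph away from `u`. On a fibre of `isolate u` the set `W` is constant, while
  -- the edges at `u` remain independent of the conditioning.
  have key : ∀ H : SimpleGraph V, μ ({G | w ≤ (W (isolate u G)).card ∧
      ∀ y ∈ W (isolate u G), ¬ G.Adj u y} ∩ isolate u ⁻¹' {H}) ≤
      μ (isolate u ⁻¹' {H}) * ENNReal.ofReal (1 - p) ^ w := by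
    intro H
    by_cases hH : isolate u ⁻¹' {H} = (∅ : Set (SimpleGraph V))
    · simp [hH]
    obtain ⟨G₀, hG₀⟩ := Set.nonempty_iff_ne_empty.2 hH
    have hG₀ : isolate u G₀ = H := hG₀
    by_cases hw : w ≤ (W H).card
    · let B : Finset (Sym2 V) := (W H).image fun y => s(u, y)
      let A : Finset (Sym2 V) := Finset.univ.filter fun e : Sym2 V => ¬ e.IsDiag ∧ u ∉ e
      have hB : B.card = (W H).card := by
        refine Finset.card_image_of_injOn fun x _ y _ h => ?_
        exact Sym2.congr_right.1 h
      have hpre : isolate u ⁻¹' {H} =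
          {G : SimpleGraph V | ∀ e ∈ A, (e ∈ G.edgeSet) = (e ∈ G₀.edgeSet)} := by
        ext G
        rw [Set.mem_preimage, Set.mem_singleton_iff, ← hG₀, isolate_eq_iff]
        rfl
      calc μ ({G | w ≤ (W (isolate u G)).card ∧
            ∀ y ∈ W (isolate u G), ¬ G.Adj u y} ∩ isolate u ⁻¹' {H})
          ≤ μ ({G | ∀ e ∈ A, (e ∈ G.edgeSet) = (e ∈ G₀.edgeSet)} ∩
            {G | ∀ e ∈ B, e ∉ G.edgeSet}) := by
            rw [← hpre]
            refine measure_mono fun G hG => ⟨hG.2, ?_⟩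
            have h2 : isolate u G = H := hG.2
            intro e he
            obtain ⟨y, hy, rfl⟩ := Finset.mem_image.1 he
            exact hG.1.2 y (h2 ▸ hy)
        _ = μ (isolate u ⁻¹' {H}) * ENNReal.ofReal (1 - p) ^ B.card := by
            rw [hpre]
            refine binomialRandom_inter_forall_notMem p A B (fun e he => (Finset.mem_filter.1 he).2.1) ?_ ?_ G₀
            · intro e he
              obtain ⟨y, hy, rfl⟩ := Finset.mem_image.1 he
              rintro h
              have : u = y := by simpa using h
              exact hu H (this ▸ hy)
            · rw [Finset.disjoint_right]
              intro e he
              obtain ⟨y, hy, rfl⟩ := Finset.mem_image.1 he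
              simp [A]
        _ ≤ _ := by
            rw [hB]
            gcongr 1
            exact pow_le_pow_right_of_le_one' hle hw
    · refine le_trans (le_of_eq ?_) zero_le
      convert measure_empty (μ := μ)
      ext G
      simp only [Set.mem_inter_iff, Set.mem_ofPred_eq, Set.mem_preimage, Set.mem_singleton_iff,
        Set.mem_empty_iff_false, iff_false, not_and]
      rintro ⟨h1, -⟩ h2
      exact hw (h2 ▸ h1)
  have huniv := sum_measure_preimage_singleton (μ := μ) (f := isolate u) Finset.univ
    (fun _ _ => (Set.toFinite _).measurableSet)
  calc μ {G | w ≤ (W (isolate u G)).card ∧ ∀ y ∈ W (isolate u G), ¬ G.Adj u y}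
      ≤ μ (⋃ H ∈ (Finset.univ : Finset (SimpleGraph V)), ({G | w ≤ (W (isolate u G)).card ∧
      ∀ y ∈ W (isolate u G), ¬ G.Adj u y} ∩ isolate u ⁻¹' {H})) := by
        refine measure_mono fun G hG => ?_
        simpa using hG
    _ ≤ ∑ H : SimpleGraph V, μ ({G | w ≤ (W (isolate u G)).card ∧
      ∀ y ∈ W (isolate u G), ¬ G.Adj u y} ∩ isolate u ⁻¹' {H}) :=
        measure_biUnion_finset_le _ _
    _ ≤ ∑ H : SimpleGraph V, μ (isolate u ⁻¹' {H}) * ENNReal.ofReal (1 - p) ^ w :=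
        Finset.sum_le_sum fun H _ => key H
    _ = ENNReal.ofReal (1 - p) ^ w := by
        rw [← Finset.sum_mul, huniv]
        simp [μ]

end GraphProbabilities

/-! ### Exponential moments of the length of a random polygonal line -/

section Positions

open scoped ENNReal

theorem measurableSet_cube (d : ℕ) : MeasurableSet (cube d) := by
  have : cube d = ⋂ i, (fun x : EuclideanSpace ℝ (Fin d) => x i) ⁻¹' Set.Icc 0 1 := by
    ext; simp [cube]
  rw [this]
  exact MeasurableSet.iInter fun i => measurableSet_Icc.preimage (by fun_prop)

/-- The volume of a box in Euclidean space. -/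
theorem volume_coordinates_mem {d : ℕ} (t : Fin d → Set ℝ) (ht : ∀ i, MeasurableSet (t i)) :
    volume {x : EuclideanSpace ℝ (Fin d) | ∀ i, x i ∈ t i} = ∏ i, volume (t i) := by
  have h := (PiLp.volume_preserving_ofLp (Fin d)).measure_preimage
    (s := Set.univ.pi t) (MeasurableSet.univ_pi ht).nullMeasurableSet
  rw [volume_pi_pi] at h
  rw [← h]
  congr 1
  ext x
  simp

instance (d : ℕ) : IsProbabilityMeasure (uniformCube d) where
  measure_univ := by
    rw [uniformCube, Measure.restrict_apply_univ, cube, volume_coordinates_mem _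
      fun _ => measurableSet_Icc]
    simp

theorem integral_exp_neg_mul_abs {a : ℝ} (ha : 0 < a) : ∫ t : ℝ, Real.exp (-(a * |t|)) = 2 / a := by
  rw [integral_comp_abs (f := fun t => Real.exp (-(a * t)))]
  have := integral_exp_mul_Ioi (a := -a) (by linarith) 0
  simp only [neg_mul] at this
  rw [this]
  simp
  ring

theorem sum_abs_le_card_mul_norm {d : ℕ} (z : EuclideanSpace ℝ (Fin d)) :
    ∑ i, |z i| ≤ d * ‖z‖ := by
  calc ∑ i, |z i| ≤ ∑ _i : Fin d, ‖z‖ := Finset.sum_le_sum fun i _ => PiLp.norm_apply_le z i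
    _ = d * ‖z‖ := by simp

/-- Since `s‖z‖ ≥ (s/d) ∑ |z i|`, the integral over the whole space is dominated by a product of `d`
one-dimensional integrals, each equal to `2d/s`. -/
theorem lintegral_exp_neg_dist_le {d : ℕ} (hd : 1 ≤ d) {s : ℝ} (hs : 0 < s)
    (x : EuclideanSpace ℝ (Fin d)) :
    ∫⁻ y, ENNReal.ofReal (Real.exp (-(s * dist y x))) ∂uniformCube d ≤
      ENNReal.ofReal ((2 * d / s) ^ d) := by
  have hd' : (0 : ℝ) < d := by exact_mod_cast hd
  have ha : 0 < s / d := by positivity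
  have hint : ∫ z : Fin d → ℝ, ∏ i, Real.exp (-(s / d * |z i|)) = (2 * d / s) ^ d := by
    rw [integral_fintype_prod_volume_eq_pow fun t : ℝ => Real.exp (-(s / d * |t|)),
      integral_exp_neg_mul_abs ha]
    simp
    congr 1
    field_simp
  have hne : (2 * d / s : ℝ) ^ d ≠ 0 := by positivity
  calc ∫⁻ y, ENNReal.ofReal (Real.exp (-(s * dist y x))) ∂uniformCube d
      ≤ ∫⁻ y : EuclideanSpace ℝ (Fin d), ENNReal.ofReal (Real.exp (-(s * dist y x))) :=
        lintegral_mono' Measure.restrict_le_self le_rfl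
    _ = ∫⁻ z : EuclideanSpace ℝ (Fin d), ENNReal.ofReal (Real.exp (-(s * ‖z‖))) := by
        simp_rw [dist_eq_norm]
        exact lintegral_sub_right_eq_self
          (fun z : EuclideanSpace ℝ (Fin d) => ENNReal.ofReal (Real.exp (-(s * ‖z‖)))) x
    _ ≤ ∫⁻ z : EuclideanSpace ℝ (Fin d),
          ENNReal.ofReal (∏ i, Real.exp (-(s / d * |z i|))) := by
        refine lintegral_mono fun z => ENNReal.ofReal_le_ofReal ?_
        rw [← Real.exp_sum]
        refine Real.exp_le_exp.2 ?_
        rw [Finset.sum_neg_distrib, ← Finset.mul_sum, neg_le_neg_iff, div_mul_eq_mul_div,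
          div_le_iff₀ hd', mul_assoc]
        have := sum_abs_le_card_mul_norm z
        nlinarith
    _ = ∫⁻ z : Fin d → ℝ, ENNReal.ofReal (∏ i, Real.exp (-(s / d * |z i|))) :=
        (PiLp.volume_preserving_ofLp (Fin d)).lintegral_comp
          (f := fun z : Fin d → ℝ => ENNReal.ofReal (∏ i, Real.exp (-(s / d * |z i|))))
          (by fun_prop)
    _ = ENNReal.ofReal ((2 * d / s) ^ d) := by
        rw [← hint, ofReal_integral_eq_lintegral_ofReal]
        -- The Bochner integral of a nonintegrable function is `0` by convention, so a nonzero value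
        -- proves integrability.
        · by_contra h
          exact hne (hint ▸ integral_undef h)
        · exact ae_of_all _ fun z => by positivity

/-- The length of the polygonal line through the positions of a list of vertices. -/
noncomputable def polyLength {V E : Type*} [Dist E] (X : V → E) : List V → ℝ
  | [] => 0
  | [_] => 0
  | a :: b :: l => dist (X a) (X b) + polyLength X (b :: l)

theorem polyLength_update {V E : Type*} [DecidableEq V] [Dist E] (X : V → E) (a : V) (y : E)
    (l : List V) (hl : a ∉ l) : polyLength (Function.update X a y) l = polyLength X l := by
  induction l with
  | nil => rfl
  | cons b l ih =>
    cases l with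
    | nil => rfl
    | cons c l =>
      simp only [List.mem_cons, not_or] at hl ih
      simp only [polyLength]
      rw [ih ⟨hl.2.1, hl.2.2⟩, Function.update_of_ne (Ne.symm hl.1),
        Function.update_of_ne (Ne.symm hl.2.1)]

@[fun_prop]
theorem measurable_polyLength {V : Type*} [Fintype V] {d : ℕ} (l : List V) :
    Measurable fun X : V → EuclideanSpace ℝ (Fin d) => polyLength X l := by
  induction l with
  | nil => exact measurable_const
  | cons b l ih =>
    cases l with
    | nil => exact measurable_const
    | cons c l =>
      simp only [polyLength]
      fun_prop

/-- The first vertex occurs only in the first segment because the list has no repetition.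
Integrating out its position, the others being fixed, gives a factor bounded uniformly in the
position of the second vertex; then induct. -/
theorem lintegral_exp_neg_polyLength_le {V : Type*} [Fintype V] [DecidableEq V] {d : ℕ}
    (hd : 1 ≤ d) {s : ℝ} (hs : 0 < s) (a : V) (l : List V) (hl : (a :: l).Nodup) :
    ∫⁻ X, ENNReal.ofReal (Real.exp (-(s * polyLength X (a :: l))))
      ∂(Measure.pi fun _ : V => uniformCube d) ≤ ENNReal.ofReal ((2 * d / s) ^ d) ^ l.length := by
  induction l generalizing a with
  | nil => simp [polyLength]
  | cons b l ih =>
    have ha : a ∉ b :: l := (List.nodup_cons.1 hl).1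
    have hab : b ≠ a := fun h => ha (by simp [h])
    calc ∫⁻ X, ENNReal.ofReal (Real.exp (-(s * polyLength X (a :: b :: l))))
          ∂(Measure.pi fun _ : V => uniformCube d)
        ≤ ∫⁻ X, ENNReal.ofReal ((2 * d / s) ^ d) *
            ENNReal.ofReal (Real.exp (-(s * polyLength X (b :: l))))
          ∂(Measure.pi fun _ : V => uniformCube d) := by
          refine lintegral_le_of_lmarginal_le {a} (by fun_prop) (by fun_prop) ?_
          rw [lmarginal_singleton, lmarginal_singleton]
          intro X
          simp only [polyLength_update X a _ _ ha, lintegral_const, measure_univ, mul_one]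
          simp only [polyLength, polyLength_update X a _ _ ha, Function.update_self,
            Function.update_of_ne hab, mul_add, neg_add, Real.exp_add,
            ENNReal.ofReal_mul (Real.exp_pos _).le]
          rw [lintegral_mul_const _ (by fun_prop)]
          gcongr
          exact lintegral_exp_neg_dist_le hd hs _
      _ = ENNReal.ofReal ((2 * d / s) ^ d) *
            ∫⁻ X, ENNReal.ofReal (Real.exp (-(s * polyLength X (b :: l))))
          ∂(Measure.pi fun _ : V => uniformCube d) := lintegral_const_mul _ (by fun_prop)
      _ ≤ _ := by
          rw [List.length_cons, pow_succ']
          gcongr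
          exact ih b (List.nodup_cons.1 hl).2

/-- The polygonal line through uniform points is unlikely to be short. -/
theorem measure_polyLength_lt_le {V : Type*} [Fintype V] [DecidableEq V] {d : ℕ}
    (hd : 1 ≤ d) {s : ℝ} (hs : 0 < s) (L : ℝ) (a : V) (l : List V) (hl : (a :: l).Nodup) :
    (Measure.pi fun _ : V => uniformCube d) {X | polyLength X (a :: l) < L} ≤
      ENNReal.ofReal (Real.exp (s * L)) * ENNReal.ofReal ((2 * d / s) ^ d) ^ l.length := by
  calc (Measure.pi fun _ : V => uniformCube d) {X | polyLength X (a :: l) < L}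
      = ∫⁻ X, {X | polyLength X (a :: l) < L}.indicator 1 X
          ∂(Measure.pi fun _ : V => uniformCube d) :=
        (lintegral_indicator_one (measurableSet_lt (by fun_prop) (by fun_prop))).symm
    -- Exponential Markov inequality: the indicator is at most `exp (s (L - length))`.
    _ ≤ ∫⁻ X, ENNReal.ofReal (Real.exp (s * L)) *
          ENNReal.ofReal (Real.exp (-(s * polyLength X (a :: l))))
          ∂(Measure.pi fun _ : V => uniformCube d) := by
        refine lintegral_mono fun X => ?_
        by_cases hX : X ∈ {X : V → EuclideanSpace ℝ (Fin d) | polyLength X (a :: l) < L}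
        swap
        · simp [Set.indicator_of_notMem hX]
        rw [Set.indicator_of_mem hX, Pi.one_apply]
        rw [← ENNReal.ofReal_mul (Real.exp_pos _).le, ← Real.exp_add]
        refine ENNReal.one_le_ofReal.2 (Real.one_le_exp ?_)
        have : polyLength X (a :: l) < L := hX
        nlinarith
    _ ≤ _ := by
        rw [lintegral_const_mul _ (by fun_prop)]
        gcongr
        exact lintegral_exp_neg_polyLength_le hd hs a l hl

end Positions

/-! ### First moment bound over paths, and part (a) -/

section Paths

open SimpleGraph
open scoped ENNReal

/-- The edges joining consecutive vertices of a list. -/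
def consecutivePairs {V : Type*} [DecidableEq V] : List V → Finset (Sym2 V)
  | [] => ∅
  | [_] => ∅
  | a :: b :: l => insert s(a, b) (consecutivePairs (b :: l))

variable {V : Type*} [DecidableEq V]

theorem mem_of_mem_consecutivePairs {e : Sym2 V} {l : List V} (he : e ∈ consecutivePairs l)
    {a : V} (ha : a ∈ e) : a ∈ l := by
  induction l with
  | nil => simp [consecutivePairs] at he
  | cons b l ih =>
    cases l with
    | nil => simp [consecutivePairs] at he
    | cons c l =>
      rcases Finset.mem_insert.1 he with rfl | he
      · rcases Sym2.mem_iff.1 ha with rfl | rfl <;> simp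
      · exact List.mem_cons_of_mem _ (ih he)

theorem card_consecutivePairs (a : V) (l : List V) (hl : (a :: l).Nodup) :
    (consecutivePairs (a :: l)).card = l.length := by
  induction l generalizing a with
  | nil => rfl
  | cons b l ih =>
    have h := List.nodup_cons.1 hl
    rw [consecutivePairs, Finset.card_insert_of_notMem, ih b h.2, List.length_cons]
    exact fun he => h.1 (mem_of_mem_consecutivePairs he (Sym2.mem_mk_left _ _))

theorem not_isDiag_of_mem_consecutivePairs {l : List V} (hl : l.Nodup) {e : Sym2 V}
    (he : e ∈ consecutivePairs l) : ¬ e.IsDiag := by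
  induction l with
  | nil => simp [consecutivePairs] at he
  | cons b l ih =>
    cases l with
    | nil => simp [consecutivePairs] at he
    | cons c l =>
      have h := List.nodup_cons.1 hl
      rcases Finset.mem_insert.1 he with rfl | he
      · rintro hbc
        have : b = c := by simpa using hbc
        exact h.1 (by simp [this])
      · exact ih h.2 he

theorem mem_edgeSet_of_isChain {G : SimpleGraph V} {l : List V} (hl : l.IsChain G.Adj)
    {e : Sym2 V} (he : e ∈ consecutivePairs l) : e ∈ G.edgeSet := by
  induction l with
  | nil => simp [consecutivePairs] at he
  | cons b l ih =>
    cases l with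
    | nil => simp [consecutivePairs] at he
    | cons c l =>
      have h := List.isChain_cons_cons.1 hl
      rcases Finset.mem_insert.1 he with rfl | he
      · exact h.1
      · exact ih h.2 he

theorem polyLength_support {d n : ℕ} (x : Outcome d n) {u v : Fin n} (w : x.2.Walk u v) :
    polyLength x.1 w.support = walkLength x w := by
  induction w with
  | nil => simp [polyLength, walkLength]
  | cons h w ih =>
    rw [Walk.support_cons, ← w.cons_tail_support, polyLength, w.cons_tail_support, ih]
    simp [walkLength]

theorem walkLength_nonneg {d n : ℕ} (x : Outcome d n) {u v : Fin n} (w : x.2.Walk u v) : 0 ≤ walkLength x w :=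
  List.sum_nonneg (by
    intro a ha
    obtain ⟨e, -, rfl⟩ := List.mem_map.1 ha
    exact dist_nonneg)

theorem walkLength_bypass_le {d n : ℕ} (x : Outcome d n) {u v : Fin n} (w : x.2.Walk u v) :
    walkLength x w.bypass ≤ walkLength x w := by
  refine List.Sublist.sum_le_sum (w.darts_bypass_sublist_darts.map _) ?_
  intro a ha
  obtain ⟨e, -, rfl⟩ := List.mem_map.1 ha
  exact dist_nonneg

/-- A vertex list from `u` to `v` with given interior. -/
theorem exists_interior {V : Type*} {u v : V} (huv : u ≠ v) {G : SimpleGraph V}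
    (w : G.Walk u v) : ∃ (k : ℕ) (g : Fin k → V), k < w.support.length ∧
      w.support = u :: (List.ofFn g ++ [v]) := by
  cases w with
  | nil => exact absurd rfl huv
  | cons h w =>
    refine ⟨w.support.dropLast.length, w.support.dropLast.get, ?_, ?_⟩
    · simp
    · rw [Walk.support_cons, List.ofFn_get]
      congr 1
      conv_lhs => rw [← List.dropLast_append_getLast w.support_ne_nil]
      rw [Walk.getLast_support]

/-- First moment bound: two given vertices are unlikely to be joined by a short path. -/
theorem law_graphDist_lt_le {d n : ℕ} (hd : 1 ≤ d) (p : unitInterval) {s : ℝ} (hs : 0 < s) (L : ℝ)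
    {u v : Fin n} (huv : u ≠ v) (h : (n : ℝ) * (p * (2 * d / s) ^ d) ≤ 1 / 2) :
    law d n p {x | graphDist x u v < ENNReal.ofReal L} ≤
      ENNReal.ofReal (Real.exp (s * L) / n) := by
  have hn : (0 : ℝ) < n := by exact_mod_cast u.pos
  let μ : Measure (Outcome d n) := law d n p
  let lst : (Σ k : Fin n, (Fin k → Fin n)) → List (Fin n) := fun g => List.ofFn g.2 ++ [v]
  -- A path is coded by its number `k < n` of interior vertices and their sequence; sequences with
  -- repetitions get the empty event.
  let A : (Σ k : Fin n, (Fin k → Fin n)) → Set (Outcome d n) := fun g =>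
    if (u :: lst g).Nodup then {X | polyLength X (u :: lst g) < L} ×ˢ
      {G | ∀ e ∈ consecutivePairs (u :: lst g), e ∈ G.edgeSet} else ∅
  have hsub : {x : Outcome d n | graphDist x u v < ENNReal.ofReal L} ⊆ ⋃ g, A g := by
    intro x hx
    obtain ⟨w, hw⟩ := iInf_lt_iff.1 (show graphDist x u v < ENNReal.ofReal L from hx)
    have hL : walkLength x w.bypass < L :=
      (walkLength_bypass_le x w).trans_lt ((ENNReal.ofReal_lt_ofReal_iff_of_nonneg
        (walkLength_nonneg x w)).1 hw)
    obtain ⟨k, g, hk, hg⟩ := exists_interior huv w.bypass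
    have hnd := w.bypass_isPath.support_nodup
    have hkn : k < n := hk.trans_le (by simpa using hnd.length_le_card)
    refine Set.mem_iUnion.2 ⟨⟨⟨k, hkn⟩, g⟩, ?_⟩
    have hnd' : (u :: lst ⟨⟨k, hkn⟩, g⟩).Nodup := hg ▸ hnd
    simp only [A, if_pos hnd']
    refine ⟨?_, fun e he => mem_edgeSet_of_isChain (l := w.bypass.support)
      w.bypass.isChain_adj_support (hg ▸ he)⟩
    show polyLength x.1 (u :: (List.ofFn g ++ [v])) < L
    rw [← hg, polyLength_support]
    exact hL
  have hA : ∀ g, μ (A g) ≤ ENNReal.ofReal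
      (Real.exp (s * L) * (p * (2 * d / s) ^ d) ^ ((g.1 : ℕ) + 1)) := by
    intro g
    by_cases hnd : (u :: lst g).Nodup
    · have hlen : (lst g).length = g.1 + 1 := by simp [lst]
      simp only [A, if_pos hnd]
      rw [show μ = (Measure.pi fun _ : Fin n => uniformCube d).prod (binomialRandom (Fin n) p)
        from rfl, Measure.prod_prod, binomialRandom_forall_mem _ _
        fun e he => not_isDiag_of_mem_consecutivePairs hnd he, card_consecutivePairs _ _ hnd]
      calc _ ≤ _ * _ := mul_le_mul_left (measure_polyLength_lt_le hd hs L u _ hnd) _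
        _ = _ := by
          rw [hlen, mul_assoc, ← mul_pow, ← ENNReal.ofReal_mul (by positivity),
            ← ENNReal.ofReal_pow (mul_nonneg (by positivity) p.2.1),
            ← ENNReal.ofReal_mul (by positivity), mul_comm (p : ℝ)]
    · simp only [A, if_neg hnd, measure_empty, zero_le]
  have hx : (0 : ℝ) ≤ n * (p * (2 * d / s) ^ d) :=
    mul_nonneg hn.le (mul_nonneg p.2.1 (by positivity))
  calc law d n p {x | graphDist x u v < ENNReal.ofReal L}
      ≤ μ (⋃ g, A g) := measure_mono hsub
    _ ≤ ∑ g, μ (A g) := measure_iUnion_fintype_le _ _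
    _ ≤ ∑ g : (Σ k : Fin n, (Fin k → Fin n)), ENNReal.ofReal
      (Real.exp (s * L) * (p * (2 * d / s) ^ d) ^ ((g.1 : ℕ) + 1)) :=
        Finset.sum_le_sum fun g _ => hA g
    _ = ENNReal.ofReal (∑ k : Fin n, n ^ (k : ℕ) *
          (Real.exp (s * L) * (p * (2 * d / s) ^ d) ^ ((k : ℕ) + 1))) := by
        rw [← ENNReal.ofReal_sum_of_nonneg, Fintype.sum_sigma]
        · simp
        · intro g _
          have := p.2.1
          positivity
    _ ≤ ENNReal.ofReal (Real.exp (s * L) / n) := by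
        refine ENNReal.ofReal_le_ofReal ?_
        -- There are `k` free vertices but `k + 1` edges; the missing factor `n` is the gain `1 /
        -- n`, and the rest is a geometric series.
        have hterm : ∀ k : ℕ, (n : ℝ) ^ k *
            (Real.exp (s * L) * (p * (2 * d / s) ^ d) ^ (k + 1)) ≤
            Real.exp (s * L) / n * ((1 / 2) ^ (k + 1)) := by
          intro k
          have : (n : ℝ) ^ k * (Real.exp (s * L) * (p * (2 * d / s) ^ d) ^ (k + 1)) =
            Real.exp (s * L) / n * (n * (p * (2 * d / s) ^ d)) ^ (k + 1) := by
            rw [mul_pow (n : ℝ)]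
            field_simp
            ring
          rw [this]
          gcongr
        refine (Finset.sum_le_sum fun k _ => hterm (k : Fin n)).trans ?_
        rw [Fin.sum_univ_eq_sum_range
          (fun k => Real.exp (s * L) / n * ((1 / 2 : ℝ) ^ (k + 1))), ← Finset.mul_sum]
        refine mul_le_of_le_one_right (by positivity) ?_
        simp_rw [pow_succ, ← Finset.sum_mul]
        have := sum_geometric_two_le n
        linarith

end Paths

theorem aas_le_graphDist (d : ℕ) (hd : 1 ≤ d) (ω : ℕ → ℝ) (hω : Tendsto ω atTop atTop)
    (p : ℕ → unitInterval)
    (hp : ∀ᶠ n : ℕ in atTop, (p n : ℝ) ≤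
        1 / (ω n ^ d * Real.log (Real.log n) ^ (2 * d)) * (Real.log n ^ d / n))
    (u v : ℕ → ℕ) (huv : ∀ᶠ n : ℕ in atTop, u n ≠ v n) :
    AAS d p fun n => {x | ∀ (hu : u n < n) (hv : v n < n),
            ENNReal.ofReal (ω n / (8 * d * Real.exp 1 ^ d)) ≤
              graphDist x ⟨u n, hu⟩ ⟨v n, hv⟩} := by
  have hd' : (0 : ℝ) < d := by exact_mod_cast hd
  have hlog : Tendsto (fun n : ℕ => Real.log n) atTop atTop :=
    Real.tendsto_log_atTop.comp tendsto_natCast_atTop_atTop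
  have hlim : Tendsto (fun n : ℕ => ENNReal.ofReal (Real.exp (-(Real.log n / 2)))) atTop (𝓝 0) := by
    rw [← ENNReal.ofReal_zero]
    refine ENNReal.tendsto_ofReal ?_
    refine Real.tendsto_exp_neg_atTop_nhds_zero.comp ?_
    exact hlog.atTop_div_const two_pos
  refine tendsto_of_tendsto_of_tendsto_of_le_of_le' tendsto_const_nhds hlim
    (Eventually.of_forall fun _ => zero_le) ?_
  filter_upwards [hp, huv, hω.eventually_gt_atTop 0, hlog.eventually_gt_atTop 0,
    (Real.tendsto_log_atTop.comp hlog).eventually_ge_atTop 1, eventually_gt_atTop 0]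
    with n hp huv hω hlogn hloglog hn
  simp only [Function.comp_apply] at hloglog
  have hn' : (0 : ℝ) < n := by exact_mod_cast hn
  set ℓ := Real.log n with hℓ
  set ll := Real.log ℓ with hll
  have hll0 : 0 < ll := by linarith
  by_cases hu : u n < n
  swap
  · simp [hu]
  by_cases hv : v n < n
  swap
  · simp [hv]
  -- This rate `s` gives `2d/s = ω ll² / (2ℓ)`, which cancels the bound on `p` and leaves `n p
  -- (2d/s)^d ≤ 2⁻ᵈ`.
  have hs : 0 < 4 * d * ℓ / (ω n * ll ^ 2) := by positivity
  have hnp : (n : ℝ) * (p n * (2 * d / (4 * d * ℓ / (ω n * ll ^ 2))) ^ d) ≤ 1 / 2 := by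
    have h1 : (2 * d / (4 * d * ℓ / (ω n * ll ^ 2))) ^ d =
        (ω n ^ d * ll ^ (2 * d)) / (2 ^ d * ℓ ^ d) := by
      rw [pow_mul, ← mul_pow, ← mul_pow, ← div_pow]
      congr 1
      field_simp
      norm_num
    rw [h1]
    calc (n : ℝ) * (p n * ((ω n ^ d * ll ^ (2 * d)) / (2 ^ d * ℓ ^ d)))
        ≤ n * (1 / (ω n ^ d * ll ^ (2 * d)) * (ℓ ^ d / n) *
          ((ω n ^ d * ll ^ (2 * d)) / (2 ^ d * ℓ ^ d))) := by gcongr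
      _ = 1 / 2 ^ d := by field_simp
      _ ≤ 1 / 2 ^ 1 := by
          gcongr
          norm_num
      _ = 1 / 2 := by norm_num
  have hmain := law_graphDist_lt_le hd (p n) hs (ω n / (8 * d * Real.exp 1 ^ d))
    (u := ⟨u n, hu⟩) (v := ⟨v n, hv⟩) (by simpa using huv) hnp
  refine le_trans (measure_mono ?_) (hmain.trans (ENNReal.ofReal_le_ofReal ?_))
  · intro x hx
    simpa [hu, hv] using hx
  · have he : 1 ≤ Real.exp 1 ^ d := one_le_pow₀ (Real.one_le_exp zero_le_one)
    -- With `s L ≤ ℓ / 2` the failure probability is at most `n^(-1/2)`.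
    have hsl : 4 * d * ℓ / (ω n * ll ^ 2) * (ω n / (8 * d * Real.exp 1 ^ d)) ≤ ℓ / 2 := by
      have : 4 * d * ℓ / (ω n * ll ^ 2) * (ω n / (8 * d * Real.exp 1 ^ d)) =
          ℓ / 2 / (ll ^ 2 * Real.exp 1 ^ d) := by
        field_simp
        norm_num
      rw [this]
      exact div_le_self (by positivity) (one_le_mul_of_one_le_of_one_le (one_le_pow₀ hloglog) he)
    calc Real.exp (4 * d * ℓ / (ω n * ll ^ 2) * (ω n / (8 * d * Real.exp 1 ^ d))) / n
        ≤ Real.exp (ℓ / 2) / n := by gcongr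
      _ = Real.exp (-(ℓ / 2)) := by
          rw [div_eq_iff hn'.ne', ← Real.exp_log hn', ← Real.exp_add]
          congr 1
          rw [← hℓ]
          ring

/-! ### Expanding cores in graphs with edges between all large sets -/

section Expansion

open scoped ENNReal

variable {V : Type*} [DecidableEq V]

open Classical in
/-- The neighbours of `S` in `Q` that lie outside `S`. -/
noncomputable def outerNeighbors (G : SimpleGraph V) (Q S : Finset V) : Finset V :=
  Q.filter fun y => y ∉ S ∧ ∃ x ∈ S, G.Adj x y

theorem mem_outerNeighbors {G : SimpleGraph V} {Q S : Finset V} {y : V} :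
    y ∈ outerNeighbors G Q S ↔ y ∈ Q ∧ y ∉ S ∧ ∃ x ∈ S, G.Adj x y := by
  simp [outerNeighbors]

/-- There is an edge between any two disjoint sets of at least `s` vertices in the given sets. -/
def Joined (G : SimpleGraph V) (s : ℕ) (Q R : Finset V) : Prop :=
  ∀ S ⊆ Q, ∀ T ⊆ R, s ≤ S.card → s ≤ T.card → Disjoint S T → ∃ x ∈ S, ∃ y ∈ T, G.Adj x y

/-- A subset of `Q` missing at most `s` vertices, in which sets of at most `s` vertices at least
double when their neighbours are added. -/
structure IsCore (G : SimpleGraph V) (s : ℕ) (Q C : Finset V) : Prop where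
  subset : C ⊆ Q
  card_le : Q.card ≤ C.card + s
  expands : ∀ S ⊆ C, S.card ≤ s → S.card ≤ (outerNeighbors G C S).card

/-- Remove a largest set `Z` with `|Z| ≤ s` that has at most `|Z|` outer neighbours. If a small `S`
failed to expand in the rest, `Z ∪ S` would also have few neighbours, so by maximality `s < |Z ∪ S|
≤ 2s`. Fewer than `s` vertices lie outside `Z ∪ S` and its at most `2s` neighbours, so `|Q| < 5s`.
-/
theorem Joined.exists_isCore {G : SimpleGraph V} {s : ℕ} {Q : Finset V} (h : Joined G s Q Q)
    (hs : 5 * s ≤ Q.card) : ∃ C, IsCore G s Q C := by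
  classical
  let F := Q.powerset.filter fun Z => Z.card ≤ s ∧ (outerNeighbors G Q Z).card ≤ Z.card
  have hF : F.Nonempty := ⟨∅, by
    simp [F, Finset.eq_empty_iff_forall_notMem, mem_outerNeighbors]⟩
  obtain ⟨Z, hZ, hmax⟩ := F.exists_max_image Finset.card hF
  simp only [F, Finset.mem_filter, Finset.mem_powerset] at hZ
  obtain ⟨hZQ, hZs, hZN⟩ := hZ
  refine ⟨Q \ Z, Finset.sdiff_subset, ?_, fun S hS hSs => ?_⟩
  · have := Finset.card_sdiff_add_card_eq_card hZQ
    omega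
  by_contra! hlt
  have hdisj : Disjoint Z S :=
    Finset.disjoint_right.2 fun y hy => (Finset.mem_sdiff.1 (hS hy)).2
  have hUQ : Z ∪ S ⊆ Q := Finset.union_subset hZQ (hS.trans Finset.sdiff_subset)
  have hUcard : (Z ∪ S).card = Z.card + S.card := Finset.card_union_of_disjoint hdisj
  have hUN : (outerNeighbors G Q (Z ∪ S)).card ≤ (Z ∪ S).card := by
    have hsub : outerNeighbors G Q (Z ∪ S) ⊆
        outerNeighbors G Q Z ∪ outerNeighbors G (Q \ Z) S := by
      intro y hy
      simp only [mem_outerNeighbors, Finset.mem_union, Finset.mem_sdiff, not_or] at hy ⊢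
      obtain ⟨hyQ, ⟨hyZ, hyS⟩, x, hx, hxy⟩ := hy
      rcases hx with hx | hx
      · exact .inl ⟨hyQ, hyZ, x, hx, hxy⟩
      · exact .inr ⟨⟨hyQ, hyZ⟩, hyS, x, hx, hxy⟩
    have := (Finset.card_le_card hsub).trans (Finset.card_union_le _ _)
    omega
  rcases le_or_gt (Z ∪ S).card s with hle | hgt
  · have := hmax (Z ∪ S) (by simp [F, hUQ, hle, hUN])
    omega
  · let T := (Q \ (Z ∪ S)) \ outerNeighbors G Q (Z ∪ S)
    have hT : T.card < s := by
      by_contra! hT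
      obtain ⟨x, hx, y, hy, hxy⟩ := h (Z ∪ S) hUQ T
        (Finset.sdiff_subset.trans Finset.sdiff_subset) hgt.le hT
        (Finset.disjoint_right.2 fun y hy => by
          simp only [T, Finset.mem_sdiff] at hy
          exact hy.1.2)
      simp only [T, Finset.mem_sdiff] at hy
      exact hy.2 (mem_outerNeighbors.2 ⟨hy.1.1, hy.1.2, x, hx, hxy⟩)
    have h1 := Finset.card_sdiff_add_card_eq_card hUQ
    have h2 : (Q \ (Z ∪ S)).card ≤ T.card + (outerNeighbors G Q (Z ∪ S)).card :=
      Finset.card_le_card_sdiff_add_card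
    omega

/-- Balls in a core grow exponentially. -/
theorem IsCore.exists_ball {G : SimpleGraph V} {s : ℕ} {Q C : Finset V} (hC : IsCore G s Q C)
    {D : V → V → ℝ≥0∞} {ρ : ℝ≥0∞} (hself : ∀ x, D x x = 0)
    (htri : ∀ x y z, D x z ≤ D x y + D y z)
    (hadj : ∀ x ∈ C, ∀ y ∈ C, G.Adj x y → D x y ≤ ρ) {x : V} (hx : x ∈ C) (t : ℕ) :
    ∃ B ⊆ C, (s < B.card ∨ 2 ^ t ≤ B.card) ∧ ∀ y ∈ B, D x y ≤ t * ρ := by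
  induction t with
  | zero => exact ⟨{x}, by simpa using hx, by simp, by simp [hself]⟩
  | succ t ih =>
    obtain ⟨B, hBC, hB, hD⟩ := ih
    -- Expansion is only known up to size `s`, so a ball that has passed this size is kept as it is.
    by_cases hs : s < B.card
    · refine ⟨B, hBC, .inl hs, fun y hy => (hD y hy).trans ?_⟩
      gcongr
      simp
    · refine ⟨B ∪ outerNeighbors G C B, Finset.union_subset hBC (fun y hy => (mem_outerNeighbors.1 hy).1),
        .inr ?_, fun y hy => ?_⟩
      · rw [Finset.card_union_of_disjoint (Finset.disjoint_right.2 fun y hy =>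
          (mem_outerNeighbors.1 hy).2.1), pow_succ]
        have := hC.expands B hBC (not_lt.1 hs)
        have := hB.resolve_left hs
        omega
      · have hcast : ((t + 1 : ℕ) : ℝ≥0∞) * ρ = t * ρ + ρ := by push_cast; ring
        rw [hcast]
        rcases Finset.mem_union.1 hy with hy | hy
        · exact (hD y hy).trans le_self_add
        · obtain ⟨hyC, -, z, hz, hzy⟩ := mem_outerNeighbors.1 hy
          exact (htri x z y).trans (add_le_add (hD z hz) (hadj z (hBC hz) y hyC hzy))

open Classical in
/-- A choice of a core of `Q`, empty if there is none. -/
noncomputable def core (G : SimpleGraph V) (s : ℕ) (Q : Finset V) : Finset V :=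
  if h : ∃ C, IsCore G s Q C then h.choose else ∅

theorem isCore_core {G : SimpleGraph V} {s : ℕ} {Q : Finset V} (h : ∃ C, IsCore G s Q C) :
    IsCore G s Q (core G s Q) := by
  rw [core, dif_pos h]
  exact h.choose_spec

theorem core_subset (G : SimpleGraph V) (s : ℕ) (Q : Finset V) : core G s Q ⊆ Q := by
  by_cases h : ∃ C, IsCore G s Q C
  · exact (isCore_core h).subset
  · simp [core, h]

/-- Edges between sets avoiding `u` survive the isolation of `u`; deleting `u` from the cell costs
one vertex, hence `5 * s + 1`. -/
theorem isCore_core_isolate [Fintype V] {G : SimpleGraph V} {s : ℕ} {Q : Finset V}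
    (h : Joined G s Q Q) (hs : 5 * s + 1 ≤ Q.card) (u : V) :
    IsCore (isolate u G) s (Q.erase u) (core (isolate u G) s (Q.erase u)) := by
  refine isCore_core (Joined.exists_isCore ?_ ?_)
  · intro S hS T hT h1 h2 h3
    obtain ⟨x, hx, y, hy, hxy⟩ := h S (hS.trans (Finset.erase_subset _ _)) T
      (hT.trans (Finset.erase_subset _ _)) h1 h2 h3
    exact ⟨x, hx, y, hy, hxy, Finset.ne_of_mem_erase (hS hx), Finset.ne_of_mem_erase (hT hy)⟩
  · have := Finset.pred_card_le_card_erase (s := Q) (a := u)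
    omega

/-- The union of the cores of the cells `Q j` with the vertex `u` removed. -/
noncomputable def coreUnion {J : Type*} [Fintype J] (s : ℕ) (Q : J → Finset V) (u : V)
    (G : SimpleGraph V) : Finset V :=
  Finset.univ.biUnion fun j => core G s ((Q j).erase u)

theorem notMem_coreUnion {J : Type*} [Fintype J] (s : ℕ) (Q : J → Finset V) (u : V)
    (G : SimpleGraph V) : u ∉ coreUnion s Q u G := by
  simp only [coreUnion, Finset.mem_biUnion, not_exists, not_and]
  exact fun j _ h => Finset.notMem_erase _ _ (core_subset _ _ _ h)

/-- Each core misses at most `u` and `s` further vertices of its cell, and disjointness of the cells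
lets the sizes add up. -/
theorem le_card_coreUnion [Fintype V] {J : Type*} [Fintype J] {s m : ℕ} {Q : J → Finset V}
    {G : SimpleGraph V} (hcard : ∀ j, (Q j).card = m)
    (hdisj : Pairwise fun i j => Disjoint (Q i) (Q j)) (hs : 5 * s + 1 ≤ m)
    (h : ∀ j, Joined G s (Q j) (Q j)) (u : V) :
    Fintype.card J * (m - 1 - s) ≤ (coreUnion s Q u (isolate u G)).card := by
  rw [coreUnion, Finset.card_biUnion, Fintype.card, ← smul_eq_mul, ← Finset.sum_const]
  · refine Finset.sum_le_sum fun j _ => ?_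
    have h1 := (isCore_core_isolate (h j) (by rw [hcard]; exact hs) u).card_le
    have h2 := Finset.pred_card_le_card_erase (s := Q j) (a := u)
    rw [hcard] at h2
    omega
  · intro i _ j _ hij
    exact (hdisj hij).mono ((core_subset _ _ _).trans (Finset.erase_subset _ _))
      ((core_subset _ _ _).trans (Finset.erase_subset _ _))

end Expansion

/-! ### The graph distance and its deterministic upper bound -/

section GraphDist

open scoped ENNReal

variable {d n : ℕ} (x : Outcome d n)

theorem graphDist_self (u : Fin n) : graphDist x u u = 0 := by
  refine le_antisymm ((iInf_le _ SimpleGraph.Walk.nil).trans ?_) zero_le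
  simp [walkLength]

theorem graphDist_triangle (u v w : Fin n) :
    graphDist x u w ≤ graphDist x u v + graphDist x v w := by
  refine ENNReal.le_iInf_add_iInf fun a b => (iInf_le _ (a.append b)).trans (le_of_eq ?_)
  rw [← ENNReal.ofReal_add (walkLength_nonneg x a) (walkLength_nonneg x b)]
  simp [walkLength]

theorem graphDist_comm (u v : Fin n) : graphDist x u v = graphDist x v u := by
  have h : ∀ u v, graphDist x u v ≤ graphDist x v u := by
    intro u v
    refine le_iInf fun w => (iInf_le _ w.reverse).trans (le_of_eq ?_)
    congr 1
    simp only [walkLength, SimpleGraph.Walk.darts_reverse, List.map_reverse, List.map_map,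
      List.sum_reverse]
    congr 1
    refine List.map_congr_left fun e _ => ?_
    simp [dist_comm]
  exact le_antisymm (h u v) (h v u)

theorem graphDist_le_of_adj {u v : Fin n} (h : x.2.Adj u v) :
    graphDist x u v ≤ edist (x.1 u) (x.1 v) := by
  refine (iInf_le _ h.toWalk).trans (le_of_eq ?_)
  simp [walkLength, edist_dist]

theorem edist_le_graphDist (u v : Fin n) : edist (x.1 u) (x.1 v) ≤ graphDist x u v := by
  refine le_iInf fun w => ?_
  rw [edist_dist]
  refine ENNReal.ofReal_le_ofReal ?_
  induction w with
  | nil => simp [walkLength]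
  | cons h w ih =>
    refine (dist_triangle _ _ _).trans ((add_le_add_right ih _).trans (le_of_eq ?_))
    simp [walkLength]

/-- Deterministic conditions under which the graph distance is close to the Euclidean one. -/
theorem graphDist_le_edist_add {I J : Type*} [Fintype J] {s m t : ℕ} (hs : 5 * s + 1 ≤ m)
    (ht : s < 2 ^ t) (coarse : Fin n → I) (Q : I → J → Finset (Fin n))
    (hcard : ∀ i j, (Q i j).card = m) (hjoin : ∀ i j i' j', Joined x.2 s (Q i j) (Q i' j'))
    (haccess : ∀ u, ∃ y ∈ coreUnion s (Q (coarse u)) u (isolate u x.2), x.2.Adj u y)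
    {R ρ : ℝ≥0∞} (hρ : ∀ i j, ∀ y ∈ Q i j, ∀ z ∈ Q i j, edist (x.1 y) (x.1 z) ≤ ρ)
    (hR : ∀ u j, ∀ y ∈ Q (coarse u) j, edist (x.1 u) (x.1 y) ≤ R) (u v : Fin n) :
    graphDist x u v ≤ edist (x.1 u) (x.1 v) + (4 * R + (2 * t + 2) * ρ) := by
  -- One edge of length at most `R` leads from `u` into a core, followed by `t` doubling steps
  -- inside that fine cell.
  have hball : ∀ u, ∃ j, ∃ B ⊆ Q (coarse u) j, s ≤ B.card ∧
      (∀ y ∈ B, graphDist x u y ≤ R + t * ρ) ∧ ∀ y ∈ B, edist (x.1 u) (x.1 y) ≤ R := by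
    intro u
    obtain ⟨y, hy, huy⟩ := haccess u
    obtain ⟨j, -, hyj⟩ := Finset.mem_biUnion.1 hy
    have hcore := isCore_core_isolate (hjoin (coarse u) j _ _) (by rw [hcard]; exact hs) u
    have hsub := hcore.subset.trans (Finset.erase_subset _ _)
    obtain ⟨B, hBC, hB, hD⟩ := hcore.exists_ball (D := graphDist x) (ρ := ρ) (graphDist_self x)
      (graphDist_triangle x) (fun a ha b hb hab => (graphDist_le_of_adj x hab.1).trans
        (hρ _ _ a (hsub ha) b (hsub hb))) hyj t
    refine ⟨j, B, hBC.trans hsub, hB.elim le_of_lt ht.le.trans, fun z hz => ?_,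
      fun z hz => hR u j z (hsub (hBC hz))⟩
    exact (graphDist_triangle x u y z).trans (add_le_add ((graphDist_le_of_adj x huy).trans
      (hR u j y (hsub hyj))) (hD z hz))
  obtain ⟨j, B, hBQ, hBs, hBD, hBR⟩ := hball u
  obtain ⟨j', B', hBQ', hBs', hBD', hBR'⟩ := hball v
  -- `Joined` speaks of disjoint sets only; if the two balls meet, a common vertex replaces the
  -- joining edge.
  have key : ∃ a ∈ B, ∃ b ∈ B', graphDist x a b ≤ edist (x.1 a) (x.1 b) := by
    by_cases hdisj : Disjoint B B'
    · obtain ⟨a, ha, b, hb, hab⟩ := hjoin _ _ _ _ B hBQ B' hBQ' hBs hBs' hdisj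
      exact ⟨a, ha, b, hb, graphDist_le_of_adj x hab⟩
    · obtain ⟨a, ha, hb⟩ := Finset.not_disjoint_iff.1 hdisj
      exact ⟨a, ha, a, hb, by simp [graphDist_self]⟩
  obtain ⟨a, ha, b, hb, hab⟩ := key
  have hab' : edist (x.1 a) (x.1 b) ≤ R + (edist (x.1 u) (x.1 v) + R) :=
    (edist_triangle _ (x.1 u) _).trans (add_le_add ((edist_comm _ _).trans_le (hBR a ha))
      ((edist_triangle _ (x.1 v) _).trans (add_le_add le_rfl (hBR' b hb))))
  calc graphDist x u v ≤ graphDist x u a + (graphDist x a b + graphDist x b v) :=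
        (graphDist_triangle x u a v).trans (add_le_add le_rfl (graphDist_triangle x a b v))
    _ ≤ (R + t * ρ) + ((R + (edist (x.1 u) (x.1 v) + R)) + (R + t * ρ)) := by
        rw [graphDist_comm x b v]
        exact add_le_add (hBD a ha) (add_le_add (hab.trans hab') (hBD' b hb))
    _ = edist (x.1 u) (x.1 v) + (4 * R + (2 * t) * ρ) := by ring
    _ ≤ _ := by
        gcongr
        exact le_self_add

end GraphDist

/-! ### Probability that the random graph is badly connected -/

section GraphFailure

open SimpleGraph
open scoped ENNReal

theorem ofReal_one_sub_le_one (p : unitInterval) : ENNReal.ofReal (1 - p) ≤ 1 := by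
  rw [ENNReal.ofReal_le_one]
  linarith [p.2.1]

/-- Union bound over at most `2^m * 2^m` pairs of subsets, each pair requiring at least `s * s`
absent edges. -/
theorem binomialRandom_not_joined_le {V : Type*} [Fintype V] [DecidableEq V] (p : unitInterval)
    {s m : ℕ} {Q R : Finset V} (hQ : Q.card = m) (hR : R.card = m) :
    binomialRandom V p {G | ¬ Joined G s Q R} ≤ 4 ^ m * ENNReal.ofReal (1 - p) ^ (s * s) := by
  classical
  let P := (Q.powerset ×ˢ R.powerset).filter fun ST =>
    s ≤ ST.1.card ∧ s ≤ ST.2.card ∧ Disjoint ST.1 ST.2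
  let E : Finset V × Finset V → Finset (Sym2 V) := fun ST =>
    (ST.1 ×ˢ ST.2).image fun xy => s(xy.1, xy.2)
  have hsub : {G : SimpleGraph V | ¬ Joined G s Q R} ⊆
      ⋃ ST ∈ P, {G | ∀ e ∈ E ST, e ∉ G.edgeSet} := by
    intro G hG
    simp only [Joined, Set.mem_ofPred_eq] at hG
    push Not at hG
    obtain ⟨S, hS, T, hT, h1, h2, h3, h4⟩ := hG
    refine Set.mem_biUnion (x := (S, T)) (by simp [P, *]) ?_
    intro e he
    obtain ⟨⟨x, y⟩, hxy, rfl⟩ := Finset.mem_image.1 he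
    exact h4 x (Finset.mem_product.1 hxy).1 y (Finset.mem_product.1 hxy).2
  have hone : ∀ ST ∈ P, binomialRandom V p {G | ∀ e ∈ E ST, e ∉ G.edgeSet} ≤
      ENNReal.ofReal (1 - p) ^ (s * s) := by
    rintro ⟨S, T⟩ hST
    obtain ⟨-, h1, h2, h3⟩ := Finset.mem_filter.1 hST
    have hne : ∀ x ∈ S, ∀ y ∈ T, x ≠ y := fun x hx y hy h =>
      Finset.disjoint_left.1 h3 hx (h ▸ hy)
    have hcard : (E (S, T)).card = S.card * T.card := by
      rw [← Finset.card_product]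
      refine Finset.card_image_of_injOn ?_
      rintro ⟨x, y⟩ hxy ⟨x', y'⟩ hxy' h
      obtain ⟨hx, hy⟩ := Finset.mem_product.1 hxy
      obtain ⟨hx', hy'⟩ := Finset.mem_product.1 hxy'
      rcases Sym2.eq_iff.1 h with ⟨h, h'⟩ | ⟨h, h'⟩
      · simp only at h h'
        rw [h, h']
      · exact absurd h (hne x hx y' hy')
    rw [binomialRandom_forall_notMem, hcard]
    · exact pow_le_pow_right_of_le_one' (ofReal_one_sub_le_one p) (Nat.mul_le_mul h1 h2)
    · intro e he
      obtain ⟨⟨x, y⟩, hxy, rfl⟩ := Finset.mem_image.1 he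
      exact fun h => hne x (Finset.mem_product.1 hxy).1 y (Finset.mem_product.1 hxy).2
        (Sym2.mk_isDiag_iff.1 h)
  have hPcard : P.card ≤ 4 ^ m := by
    refine (Finset.card_filter_le _ _).trans ?_
    rw [Finset.card_product, Finset.card_powerset, Finset.card_powerset, hQ, hR, ← mul_pow]
    norm_num
  calc _ ≤ _ := measure_mono hsub
    _ ≤ ∑ ST ∈ P, binomialRandom V p {G | ∀ e ∈ E ST, e ∉ G.edgeSet} :=
        measure_biUnion_finset_le _ _
    _ ≤ P.card • ENNReal.ofReal (1 - p) ^ (s * s) := Finset.sum_le_card_nsmul _ _ _ hone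
    _ ≤ _ := by
        rw [nsmul_eq_mul]
        gcongr
        exact_mod_cast hPcard

/-- The edges of `G` connect the cells well: all pairs of cells are joined, and every vertex is
adjacent to the core of some fine cell within its coarse cell. -/
structure WellConnected {V I J : Type*} [DecidableEq V] [Fintype V] [Fintype J] (s : ℕ)
    (coarse : V → I)
    (Q : I → J → Finset V) (G : SimpleGraph V) : Prop where
  joined : ∀ i j i' j', Joined G s (Q i j) (Q i' j')
  access : ∀ u, ∃ y ∈ coreUnion s (Q (coarse u)) u (isolate u G), G.Adj u y

/-- Union bound over pairs of cells and over vertices. Failure of access need only be counted when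
all cells are joined, and then the cores are large enough for `binomialRandom_forall_not_adj_le`. -/
theorem binomialRandom_not_wellConnected_le {V I J : Type*} [DecidableEq V] [Fintype V] [Fintype I]
    [Fintype J] (p : unitInterval) {s m : ℕ} (hs : 5 * s + 1 ≤ m) (coarse : V → I)
    (Q : I → J → Finset V) (hcard : ∀ i j, (Q i j).card = m)
    (hdisj : ∀ i, Pairwise fun j j' => Disjoint (Q i j) (Q i j')) :
    binomialRandom V p {G | ¬ WellConnected s coarse Q G} ≤
      (Fintype.card (I × J)) ^ 2 * (4 ^ m * ENNReal.ofReal (1 - p) ^ (s * s)) +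
        Fintype.card V * ENNReal.ofReal (1 - p) ^ (Fintype.card J * (m - 1 - s)) := by
  have hsub : {G : SimpleGraph V | ¬ WellConnected s coarse Q G} ⊆
      (⋃ a : (I × J) × (I × J), {G | ¬ Joined G s (Q a.1.1 a.1.2) (Q a.2.1 a.2.2)}) ∪
      ⋃ u, {G | Fintype.card J * (m - 1 - s) ≤ (coreUnion s (Q (coarse u)) u (isolate u G)).card ∧
        ∀ y ∈ coreUnion s (Q (coarse u)) u (isolate u G), ¬ G.Adj u y} := by
    intro G hG
    by_cases hj : ∀ i j i' j', Joined G s (Q i j) (Q i' j')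
    · have ha : ¬ ∀ u, ∃ y ∈ coreUnion s (Q (coarse u)) u (isolate u G), G.Adj u y :=
        fun ha => hG ⟨hj, ha⟩
      push Not at ha
      obtain ⟨u, hu⟩ := ha
      exact .inr (Set.mem_iUnion.2 ⟨u, le_card_coreUnion (hcard _) (hdisj _) hs
        (fun j => hj _ _ _ _) u, hu⟩)
    · push Not at hj
      obtain ⟨i, j, i', j', h⟩ := hj
      exact .inl (Set.mem_iUnion.2 ⟨((i, j), (i', j')), h⟩)
  refine (measure_mono hsub).trans ((measure_union_le _ _).trans (add_le_add ?_ ?_))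
  · refine (measure_iUnion_fintype_le _ _).trans ?_
    refine (Finset.sum_le_card_nsmul _ _ _ fun a _ =>
      binomialRandom_not_joined_le p (hcard _ _) (hcard _ _)).trans (le_of_eq ?_)
    rw [nsmul_eq_mul, Finset.card_univ, Fintype.card_prod (I × J) (I × J)]
    push_cast
    ring
  · refine (measure_iUnion_fintype_le _ _).trans ?_
    refine (Finset.sum_le_card_nsmul _ _ _ fun u _ =>
      binomialRandom_forall_not_adj_le p u _ (coreUnion s (Q (coarse u)) u)
        (notMem_coreUnion _ _ _)).trans (le_of_eq ?_)
    rw [nsmul_eq_mul, Finset.card_univ]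

end GraphFailure

/-! ### Lower tail for the number of points in a set -/

section Counting

open scoped ENNReal
open Classical in
/-- Exponential moment bound for the number of points in a set. -/
theorem pi_card_filter_lt_le {V E : Type*} [Fintype V] [MeasurableSpace E] (ν : Measure E)
    [IsProbabilityMeasure ν] {A : Set E} (hA : MeasurableSet A) {q : ℝ}
    (hqA : ENNReal.ofReal q ≤ ν A) (m : ℕ) :
    (Measure.pi fun _ : V => ν) {X | (Finset.univ.filter fun v => X v ∈ A).card < m} ≤
      2 ^ m * ENNReal.ofReal (1 - q / 2) ^ Fintype.card V := by
  -- The product of the weights `g` is `2` to the minus number of points in `A`; by independence its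
  -- expectation is a power, and Markov concludes.
  let g : E → ℝ≥0∞ := fun y => A.indicator (fun _ => 2⁻¹) y + Aᶜ.indicator 1 y
  have hg : Measurable g := by
    refine Measurable.add (measurable_const.indicator hA) (measurable_one.indicator hA.compl)
  have hgA : ∀ y, g y = if y ∈ A then 2⁻¹ else 1 := by
    intro y
    by_cases hy : y ∈ A <;> simp [g, hy]
  have hint : ∫⁻ y, g y ∂ν ≤ ENNReal.ofReal (1 - q / 2) := by
    have hreal : q ≤ ν.real A := by
      rw [Measure.real]
      exact (ENNReal.ofReal_le_iff_le_toReal (measure_ne_top _ _)).1 hqA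
    rw [lintegral_add_left (measurable_const.indicator hA), lintegral_indicator_const hA,
      lintegral_indicator_one hA.compl, ← ofReal_measureReal, ← ofReal_measureReal,
      probReal_compl_eq_one_sub hA,
      show (2⁻¹ : ℝ≥0∞) = ENNReal.ofReal (1 / 2) by
        rw [ENNReal.ofReal_div_of_pos two_pos]; simp,
      ← ENNReal.ofReal_mul (by norm_num),
      ← ENNReal.ofReal_add (by positivity) (by linarith [measureReal_le_one (μ := ν) (s := A)])]
    exact ENNReal.ofReal_le_ofReal (by linarith)
  have hprod : ∫⁻ X, ∏ v, g (X v) ∂(Measure.pi fun _ : V => ν) =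
      (∫⁻ y, g y ∂ν) ^ Fintype.card V := by
    have hind := ProbabilityTheory.iIndepFun_pi (μ := fun _ : V => ν) (X := fun _ : V => g)
      (fun _ => hg.aemeasurable)
    rw [ProbabilityTheory.lintegral_prod_eq_prod_lintegral_of_indepFun Finset.univ _ hind
      (fun v => hg.comp (measurable_pi_apply v))]
    rw [Finset.prod_congr rfl fun v _ =>
      (measurePreserving_eval (fun _ : V => ν) v).lintegral_comp hg]
    simp
  calc (Measure.pi fun _ : V => ν) {X | (Finset.univ.filter fun v => X v ∈ A).card < m}
      ≤ (Measure.pi fun _ : V => ν) {X | 1 ≤ 2 ^ m * ∏ v, g (X v)} := by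
        refine measure_mono fun X hX => ?_
        have hX : (Finset.univ.filter fun v => X v ∈ A).card < m := hX
        simp only [hgA, Set.mem_ofPred_eq, Finset.prod_ite, Finset.prod_const, one_pow,
          mul_one]
        rw [← ENNReal.inv_pow, ← div_eq_mul_inv,
          ENNReal.le_div_iff_mul_le (.inl (by simp)) (.inl (by simp)), one_mul]
        exact pow_le_pow_right₀ one_le_two hX.le
    _ ≤ ∫⁻ X, 2 ^ m * ∏ v, g (X v) ∂(Measure.pi fun _ : V => ν) := by
        have := mul_meas_ge_le_lintegral (μ := Measure.pi fun _ : V => ν)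
          (f := fun X => 2 ^ m * ∏ v, g (X v)) (by fun_prop) 1
        simpa using this
    _ ≤ _ := by
        rw [lintegral_const_mul _ (by fun_prop), hprod]
        gcongr

end Counting

/-! ### The two-level grid of cells -/

section Cells

open scoped ENNReal

/-- The index of the interval of length `1 / k` that contains `t ∈ [0,1]`. -/
noncomputable def intervalIndex (k : ℕ) [NeZero k] (t : ℝ) : Fin k :=
  ⟨min ⌊k * t⌋₊ (k - 1), (min_le_right _ _).trans_lt (Nat.sub_lt (NeZero.pos k) one_pos)⟩

theorem measurable_intervalIndex (k : ℕ) [NeZero k] : Measurable (intervalIndex k) := by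
  have h : Measurable fun t : ℝ => min ⌊k * t⌋₊ (k - 1) :=
    (Nat.measurable_floor.comp (measurable_const_mul _)).min measurable_const
  refine measurable_to_countable' fun i => ?_
  have : intervalIndex k ⁻¹' {i} = (fun t : ℝ => min ⌊k * t⌋₊ (k - 1)) ⁻¹' {(i : ℕ)} := by
    ext t
    simp [intervalIndex, Fin.ext_iff]
  rw [this]
  exact h .of_discrete

theorem mem_Icc_intervalIndex (k : ℕ) [NeZero k] {t : ℝ} (ht : t ∈ Set.Icc (0 : ℝ) 1) :
    t ∈ Set.Icc ((intervalIndex k t : ℕ) / k : ℝ) (((intervalIndex k t : ℕ) + 1) / k) := by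
  have hk : (0 : ℝ) < k := by exact_mod_cast NeZero.pos k
  have h0 : 0 ≤ k * t := mul_nonneg hk.le ht.1
  constructor
  · rw [div_le_iff₀ hk, mul_comm]
    refine le_trans ?_ (Nat.floor_le h0)
    exact_mod_cast min_le_left _ _
  · rw [le_div_iff₀ hk, mul_comm]
    simp only [intervalIndex]
    rcases le_total ⌊k * t⌋₊ (k - 1) with h | h
    · rw [min_eq_left h]
      exact (Nat.lt_floor_add_one _).le
    · rw [min_eq_right h, Nat.cast_sub (NeZero.pos k)]
      have := mul_le_mul_of_nonneg_left ht.2 hk.le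
      push_cast
      linarith

theorem Ico_subset_intervalIndex (k : ℕ) [NeZero k] (i : Fin k) :
    Set.Ico ((i : ℕ) / k : ℝ) (((i : ℕ) + 1) / k) ⊆ intervalIndex k ⁻¹' {i} ∩ Set.Icc 0 1 := by
  have hk : (0 : ℝ) < k := by exact_mod_cast NeZero.pos k
  intro t ht
  have h1 := (div_le_iff₀' hk).1 ht.1
  have h2 := (lt_div_iff₀' hk).1 ht.2
  have hfloor : ⌊k * t⌋₊ = i := (Nat.floor_eq_iff (le_trans (by positivity) h1)).2 ⟨h1, h2⟩
  have hik : ((i : ℕ) + 1 : ℝ) ≤ k := by exact_mod_cast i.2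
  refine ⟨?_, le_trans (by positivity) ht.1, ht.2.le.trans ((div_le_one hk).2 hik)⟩
  simp only [Set.mem_preimage, Set.mem_singleton_iff, intervalIndex, Fin.ext_iff, hfloor]
  exact min_eq_left (Nat.le_sub_one_of_lt i.2)

variable (d b h : ℕ) [NeZero b] [NeZero h]

/-- The coarse and fine coordinates of the cell containing a point of the cube, which is divided
into `b ^ d` coarse cells, each divided into `h ^ d` fine cells. -/
noncomputable def cell (x : EuclideanSpace ℝ (Fin d)) : (Fin d → Fin b) × (Fin d → Fin h) :=
  (fun i => (intervalIndex (b * h) (x i)).divNat, fun i => (intervalIndex (b * h) (x i)).modNat)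

theorem measurable_cell : Measurable (cell d b h) := by
  refine Measurable.prodMk (measurable_pi_lambda _ fun i => ?_) (measurable_pi_lambda _ fun i => ?_)
  · exact (Measurable.of_discrete (f := Fin.divNat)).comp
      ((measurable_intervalIndex _).comp (by fun_prop))
  · exact (Measurable.of_discrete (f := Fin.modNat)).comp
      ((measurable_intervalIndex _).comp (by fun_prop))

/-- A half-open box of side `1 / (b h)` lies in the cell. Only a lower bound is needed, so the
treatment of the boundary of the cube does not matter. -/
theorem le_uniformCube_cell (a : (Fin d → Fin b) × (Fin d → Fin h)) :
    ENNReal.ofReal (1 / ((b * h) ^ d : ℕ)) ≤ uniformCube d (cell d b h ⁻¹' {a}) := by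
  rw [uniformCube, Measure.restrict_apply' (measurableSet_cube d)]
  let i : Fin d → Fin (b * h) := fun k => finProdFinEquiv (a.1 k, a.2 k)
  have hvol := volume_coordinates_mem
    (fun k => Set.Ico ((i k : ℕ) / (b * h : ℕ) : ℝ) (((i k : ℕ) + 1) / (b * h : ℕ)))
    fun _ => measurableSet_Ico
  have hval : ENNReal.ofReal (1 / ((b * h) ^ d : ℕ)) =
      ∏ k, volume (Set.Ico ((i k : ℕ) / (b * h : ℕ) : ℝ) (((i k : ℕ) + 1) / (b * h : ℕ))) := by
    simp only [Real.volume_Ico, ← sub_div, add_sub_cancel_left, Finset.prod_const,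
      Finset.card_univ, Fintype.card_fin]
    rw [← ENNReal.ofReal_pow (by positivity), one_div_pow, Nat.cast_pow]
  rw [hval, ← hvol]
  refine measure_mono fun x hx => ?_
  have hx' := fun k => Ico_subset_intervalIndex (b * h) (i k) (hx k)
  refine ⟨?_, fun k => (hx' k).2⟩
  have hdm : ∀ k, (intervalIndex (b * h) (x k)).divNat = a.1 k ∧
      (intervalIndex (b * h) (x k)).modNat = a.2 k := by
    intro k
    have h1 : intervalIndex (b * h) (x k) = finProdFinEquiv (a.1 k, a.2 k) := (hx' k).1
    have h2 := finProdFinEquiv.symm_apply_apply (a.1 k, a.2 k)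
    rw [← h1] at h2
    exact ⟨congr_arg Prod.fst h2, congr_arg Prod.snd h2⟩
  simp only [Set.mem_preimage, Set.mem_singleton_iff, cell]
  exact Prod.ext (funext fun k => (hdm k).1) (funext fun k => (hdm k).2)

variable {d b h}

theorem edist_le_of_forall_abs_sub_le {x y : EuclideanSpace ℝ (Fin d)} {r : ℝ} (hr : 0 ≤ r)
    (hxy : ∀ i, |x i - y i| ≤ r) : edist x y ≤ ENNReal.ofReal (d * r) := by
  rw [edist_dist]
  refine ENNReal.ofReal_le_ofReal ?_
  rw [EuclideanSpace.dist_eq]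
  refine Real.sqrt_le_iff.2 ⟨by positivity, ?_⟩
  calc ∑ i, dist (x i) (y i) ^ 2 ≤ ∑ _i : Fin d, r ^ 2 :=
        Finset.sum_le_sum fun i _ => pow_le_pow_left₀ dist_nonneg (hxy i) 2
    _ = d * r ^ 2 := by simp
    _ ≤ (d * r) ^ 2 := by
        rw [mul_pow]
        gcongr
        exact_mod_cast Nat.le_self_pow two_ne_zero d

theorem edist_le_of_cell_eq {x y : EuclideanSpace ℝ (Fin d)} (hx : x ∈ cube d) (hy : y ∈ cube d)
    (hxy : cell d b h x = cell d b h y) : edist x y ≤ ENNReal.ofReal (d * (1 / (b * h))) := by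
  have hb : (0 : ℝ) < b := by exact_mod_cast NeZero.pos b
  have hh : (0 : ℝ) < h := by exact_mod_cast NeZero.pos h
  refine edist_le_of_forall_abs_sub_le (by positivity) fun i => ?_
  have hidx : intervalIndex (b * h) (x i) = intervalIndex (b * h) (y i) := by
    refine finProdFinEquiv.symm.injective (Prod.ext ?_ ?_)
    · exact congr_fun (congr_arg Prod.fst hxy) i
    · exact congr_fun (congr_arg Prod.snd hxy) i
  have h1 := mem_Icc_intervalIndex (b * h) (hx i)
  have h2 := mem_Icc_intervalIndex (b * h) (hy i)
  rw [hidx] at h1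
  have h3 := abs_sub_le_of_le_of_le h1.1 h1.2 h2.1 h2.2
  rw [← sub_div, add_sub_cancel_left] at h3
  push_cast at h3
  exact h3

theorem edist_le_of_coarse_eq {x y : EuclideanSpace ℝ (Fin d)} (hx : x ∈ cube d) (hy : y ∈ cube d)
    (hxy : (cell d b h x).1 = (cell d b h y).1) : edist x y ≤ ENNReal.ofReal (d * (1 / b)) := by
  have hb : (0 : ℝ) < b := by exact_mod_cast NeZero.pos b
  have hh : (0 : ℝ) < h := by exact_mod_cast NeZero.pos h
  have key : ∀ t ∈ Set.Icc (0 : ℝ) 1,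
      t ∈ Set.Icc (((intervalIndex (b * h) t).divNat : ℕ) / b : ℝ)
        ((((intervalIndex (b * h) t).divNat : ℕ) + 1) / b) := by
    intro t ht
    obtain ⟨h1, h2⟩ := mem_Icc_intervalIndex (b * h) ht
    set k := intervalIndex (b * h) t with hk
    have hlo : ((k.divNat : ℕ) : ℝ) * h ≤ (k : ℕ) := by
      rw [Fin.coe_divNat]
      exact_mod_cast Nat.div_mul_le_self _ _
    have hhi : ((k : ℕ) : ℝ) + 1 ≤ ((k.divNat : ℕ) + 1) * h := by
      rw [Fin.coe_divNat]
      exact_mod_cast Nat.lt_div_mul_add (NeZero.pos h) |>.trans_eq (by ring)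
    push_cast at h1 h2
    constructor
    · refine le_trans ?_ h1
      rw [div_le_div_iff₀ hb (by positivity)]
      nlinarith
    · refine h2.trans ?_
      rw [div_le_div_iff₀ (by positivity) hb]
      nlinarith
  refine edist_le_of_forall_abs_sub_le (by positivity) fun i => ?_
  have hidx : (intervalIndex (b * h) (x i)).divNat = (intervalIndex (b * h) (y i)).divNat :=
    congr_fun hxy i
  have h1 := key _ (hx i)
  have h2 := key _ (hy i)
  rw [hidx] at h1
  have h3 := abs_sub_le_of_le_of_le h1.1 h1.2 h2.1 h2.2
  rwa [← sub_div, add_sub_cancel_left] at h3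

end Cells

/-! ### Failure probability for fixed parameters -/

section UpperBound

open scoped ENNReal

/-- The outcomes in which all graph distances exceed the Euclidean ones by at most `δ`. -/
def distortionLE (d n : ℕ) (δ : ℝ≥0∞) : Set (Outcome d n) :=
  {x | ∀ u v : Fin n, graphDist x u v ≤ edist (x.1 u) (x.1 v) + δ}

theorem ae_forall_mem_cube (d n : ℕ) (p : unitInterval) :
    law d n p {x | ¬ ∀ v, x.1 v ∈ cube d} = 0 := by
  have hone : ∀ᵐ y ∂uniformCube d, y ∈ cube d := ae_restrict_mem (measurableSet_cube d)
  have h : ∀ᵐ X ∂(Measure.pi fun _ : Fin n => uniformCube d), ∀ v, X v ∈ cube d :=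
    ae_all_iff.2 fun v =>
      (measurePreserving_eval (fun _ : Fin n => uniformCube d) v).quasiMeasurePreserving.ae hone
  have h' : {x : Outcome d n | ¬ ∀ v, x.1 v ∈ cube d} =
      {X | ¬ ∀ v, X v ∈ cube d} ×ˢ Set.univ := by
    ext; simp
  rw [h', law, Measure.prod_prod, ae_iff.1 h, zero_mul]

/-- An event that is unlikely for each value of a discrete function of the positions is
unlikely. -/
theorem law_le_of_forall {d n : ℕ} (p : unitInterval) {ι : Type*} [Countable ι] [MeasurableSpace ι]
    [DiscreteMeasurableSpace ι] {c : (Fin n → EuclideanSpace ℝ (Fin d)) → ι} (hc : Measurable c)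
    (B : ι → Set (SimpleGraph (Fin n))) {β : ℝ≥0∞}
    (hB : ∀ i, SimpleGraph.binomialRandom (Fin n) p (B i) ≤ β) :
    law d n p {x | x.2 ∈ B (c x.1)} ≤ β := by
  have hmeas : MeasurableSet {x : Outcome d n | x.2 ∈ B (c x.1)} := by
    have : {x : Outcome d n | x.2 ∈ B (c x.1)} =
        (fun x : Outcome d n => (c x.1, x.2)) ⁻¹' {y | y.2 ∈ B y.1} := rfl
    rw [this]
    exact ((hc.comp measurable_fst).prodMk measurable_snd) .of_discrete
  rw [law, Measure.prod_apply hmeas]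
  calc _ ≤ ∫⁻ _, β ∂(Measure.pi fun _ : Fin n => uniformCube d) :=
        lintegral_mono fun X => hB (c X)
    _ = β := by simp

/-- Given the cell of every vertex, the chosen sets `Q` are deterministic and the graph is still
binomial, so the graph estimate holds uniformly over cell patterns. The first term bounds the chance
of an underpopulated cell. -/
theorem law_compl_distortionLE_le (d n b h : ℕ) [NeZero b] [NeZero h] (p : unitInterval)
    {s m t : ℕ} (hs : 5 * s + 1 ≤ m) (ht : s < 2 ^ t) :
    law d n p (distortionLE d n (4 * ENNReal.ofReal (d * (1 / b)) +
        (2 * t + 2) * ENNReal.ofReal (d * (1 / (b * h)))))ᶜ ≤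
      ((b * h) ^ d : ℕ) * (2 ^ m * ENNReal.ofReal (1 - 1 / ((b * h) ^ d : ℕ) / 2) ^ n) +
      (((b * h) ^ d : ℕ) ^ 2 * (4 ^ m * ENNReal.ofReal (1 - p) ^ (s * s)) +
        n * ENNReal.ofReal (1 - p) ^ (h ^ d * (m - 1 - s))) := by
  classical
  let I := Fin d → Fin b
  let J := Fin d → Fin h
  have hIJ : Fintype.card (I × J) = (b * h) ^ d := by
    simp [I, J, mul_pow]
  have hJ : Fintype.card J = h ^ d := by simp [J]
  let full : (Fin n → I × J) → Prop := fun c =>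
    ∀ a, m ≤ (Finset.univ.filter fun v => c v = a).card
  have hchoose : ∀ (c : Fin n → I × J) (a : I × J), ∃ Q : Finset (Fin n), full c →
      Q ⊆ Finset.univ.filter (fun v => c v = a) ∧ Q.card = m := by
    intro c a
    by_cases hc : full c
    · obtain ⟨Q, hQ⟩ := Finset.exists_subset_card_eq (hc a)
      exact ⟨Q, fun _ => hQ⟩
    · exact ⟨∅, fun h => absurd h hc⟩
  choose Q hQ using hchoose
  -- Including `full c` makes the event empty for patterns with a sparse cell, where `Q` carries no
  -- information.
  let B : (Fin n → I × J) → Set (SimpleGraph (Fin n)) := fun c =>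
    {G | full c ∧ ¬ WellConnected s (fun v => (c v).1) (fun i j => Q c (i, j)) G}
  let cells : (Fin n → EuclideanSpace ℝ (Fin d)) → Fin n → I × J := fun X v => cell d b h (X v)
  have hcells : Measurable cells :=
    measurable_pi_lambda _ fun v => (measurable_cell d b h).comp (measurable_pi_apply v)
  have hsub : (distortionLE d n (4 * ENNReal.ofReal (d * (1 / b)) +
        (2 * t + 2) * ENNReal.ofReal (d * (1 / (b * h)))))ᶜ ⊆
      {x | ¬ ∀ v, x.1 v ∈ cube d} ∪
      ((⋃ a : I × J, {X | (Finset.univ.filter fun v => X v ∈ cell d b h ⁻¹' {a}).card < m} ×ˢ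
        Set.univ) ∪ {x | x.2 ∈ B (cells x.1)}) := by
    intro x hx
    by_contra hcon
    simp only [Set.mem_union, not_or, Set.mem_ofPred_eq, not_not, Set.mem_iUnion, not_exists] at hcon
    obtain ⟨hcube, hcount, hB⟩ := hcon
    have hfull : full (cells x.1) := by
      intro a
      by_contra! hlt
      refine hcount a ⟨lt_of_le_of_lt (Finset.card_le_card fun v hv => ?_) hlt, Set.mem_univ _⟩
      simpa [cells] using hv
    have hwell : WellConnected s (fun v => (cells x.1 v).1) (fun i j => Q (cells x.1) (i, j)) x.2 := by
      by_contra hw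
      exact hB ⟨hfull, hw⟩
    have hmem : ∀ a, ∀ y ∈ Q (cells x.1) a, cell d b h (x.1 y) = a := fun a y hy =>
      (Finset.mem_filter.1 ((hQ _ a hfull).1 hy)).2
    refine hx fun u v => graphDist_le_edist_add x hs ht (fun v => (cells x.1 v).1)
      (fun i j => Q (cells x.1) (i, j)) (fun i j => (hQ _ _ hfull).2) hwell.joined hwell.access
      (fun i j y hy z hz => ?_) (fun u j y hy => ?_) u v
    · exact edist_le_of_cell_eq (hcube y) (hcube z) ((hmem _ y hy).trans (hmem _ z hz).symm)
    · refine edist_le_of_coarse_eq (b := b) (h := h) (hcube u) (hcube y) ?_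
      rw [hmem _ y hy]
  refine (measure_mono hsub).trans ((measure_union_le _ _).trans ?_)
  rw [ae_forall_mem_cube, zero_add]
  refine (measure_union_le _ _).trans (add_le_add ?_ ?_)
  · refine (measure_iUnion_fintype_le _ _).trans ((Finset.sum_le_card_nsmul _ _ (2 ^ m *
      ENNReal.ofReal (1 - 1 / ((b * h) ^ d : ℕ) / 2) ^ n) fun a _ => ?_).trans (le_of_eq ?_))
    · rw [law, Measure.prod_prod, measure_univ, mul_one]
      have := pi_card_filter_lt_le (V := Fin n) (uniformCube d)
        (measurable_cell d b h (.singleton a)) (le_uniformCube_cell d b h a) m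
      rw [Fintype.card_fin] at this
      convert this using 8
    · rw [nsmul_eq_mul, Finset.card_univ, hIJ]
  · refine law_le_of_forall p hcells B fun c => ?_
    by_cases hc : full c
    · have := binomialRandom_not_wellConnected_le p hs (fun v => (c v).1)
        (fun i j => Q c (i, j)) (fun i j => (hQ c _ hc).2) (fun i j j' hjj' => by
          refine Finset.disjoint_left.2 fun v hv hv' => hjj' ?_
          have h1 := (Finset.mem_filter.1 ((hQ c _ hc).1 hv)).2
          have h2 := (Finset.mem_filter.1 ((hQ c _ hc).1 hv')).2
          exact congr_arg Prod.snd (h1.symm.trans h2))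
      rw [hIJ, hJ, Fintype.card_fin] at this
      refine (measure_mono fun G hG => ?_).trans this
      exact hG.2
    · simp [B, hc]

theorem one_sub_pow_le_exp {q : ℝ} (hq : q ≤ 1) (k : ℕ) : (1 - q) ^ k ≤ Real.exp (-(q * k)) := by
  calc (1 - q) ^ k ≤ Real.exp (-q) ^ k :=
        pow_le_pow_left₀ (by linarith) (Real.one_sub_le_exp_neg q) k
    _ = Real.exp (-(q * k)) := by
        rw [← Real.exp_nat_mul]
        congr 1
        ring

/-- The failure probability is at most `3 / n` if the fine cells are large enough. -/
theorem failure_le {n k l m s : ℕ} {p : unitInterval} (hn : 0 < n) (hkn : k ≤ n) (hk : 0 < k)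
    (hm : (m : ℝ) ≤ n / (2 * k)) (hms : (m : ℝ) / 10 ≤ s) (hsm : m ≤ 2 * (m - 1 - s))
    (hlog : 12 * Real.log n ≤ m) (hpm : 300 ≤ (p : ℝ) * m) (hlpm : 4 * Real.log n ≤ l * (p * m)) :
    (k : ℝ≥0∞) * (2 ^ m * ENNReal.ofReal (1 - 1 / k / 2) ^ n) +
      ((k : ℝ≥0∞) ^ 2 * (4 ^ m * ENNReal.ofReal (1 - p) ^ (s * s)) +
        n * ENNReal.ofReal (1 - p) ^ (l * (m - 1 - s))) ≤ ENNReal.ofReal (3 / n) := by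
  have hn' : (0 : ℝ) < n := by exact_mod_cast hn
  have hk' : (0 : ℝ) < k := by exact_mod_cast hk
  have hk1 : (1 : ℝ) ≤ k := by exact_mod_cast hk
  have hkn' : (k : ℝ) ≤ n := by exact_mod_cast hkn
  have hp0 : (0 : ℝ) ≤ p := p.2.1
  have hp1 : (p : ℝ) ≤ 1 := p.2.2
  have hexpn : Real.exp (Real.log n) = n := Real.exp_log hn'
  have hlog0 : 0 ≤ Real.log n := Real.log_natCast_nonneg n
  have h1k : (1 : ℝ) / k ≤ 1 := (div_le_one hk').2 hk1
  have e2 : (2 : ℝ) ^ m ≤ Real.exp (3 / 4 * m) := by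
    rw [mul_comm, Real.exp_nat_mul]
    refine pow_le_pow_left₀ two_pos.le ?_ m
    rw [← Real.exp_log two_pos]
    exact Real.exp_le_exp.2 (by linarith [Real.log_two_lt_d9])
  have e4 : (4 : ℝ) ^ m ≤ Real.exp (2 * m) := by
    have : (4 : ℝ) ^ m = 2 ^ m * 2 ^ m := by rw [← mul_pow]; norm_num
    rw [this]
    calc (2 : ℝ) ^ m * 2 ^ m ≤ Real.exp (3 / 4 * m) * Real.exp (3 / 4 * m) := by gcongr
      _ = Real.exp (3 / 4 * m + 3 / 4 * m) := (Real.exp_add _ _).symm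
      _ ≤ Real.exp (2 * m) := Real.exp_le_exp.2 (by linarith)
  have hinv : (1 : ℝ) / n = Real.exp (-Real.log n) := by rw [Real.exp_neg, hexpn, one_div]
  have T1 : (k : ℝ) * (2 ^ m * (1 - 1 / k / 2) ^ n) ≤ 1 / n := by
    calc (k : ℝ) * (2 ^ m * (1 - 1 / k / 2) ^ n)
        ≤ n * (Real.exp (3 / 4 * m) * Real.exp (-(1 / k / 2 * n))) := by
          have h0 : 0 ≤ (1 - 1 / (k : ℝ) / 2) ^ n := pow_nonneg (by linarith) _
          exact mul_le_mul hkn' (mul_le_mul e2 (one_sub_pow_le_exp (by linarith) n) h0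
            (Real.exp_pos _).le) (by positivity) hn'.le
      _ = Real.exp (Real.log n + (3 / 4 * m + -(1 / k / 2 * n))) := by
          rw [Real.exp_add, Real.exp_add, hexpn]
      _ ≤ 1 / n := by
          rw [hinv]
          refine Real.exp_le_exp.2 ?_
          -- The exponent is at most `log n + 3m/4 - m`, and `12 log n ≤ m` makes this at most `-log
          -- n`.
          have : (1 : ℝ) / k / 2 * n = n / (2 * k) := by field_simp
          rw [this]
          linarith
  have T2 : (k : ℝ) ^ 2 * (4 ^ m * (1 - p) ^ (s * s)) ≤ 1 / n := by
    calc (k : ℝ) ^ 2 * (4 ^ m * (1 - p) ^ (s * s))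
        ≤ n ^ 2 * (Real.exp (2 * m) * Real.exp (-(p * (s * s : ℕ)))) := by
          have h0 : 0 ≤ (1 - (p : ℝ)) ^ (s * s) := pow_nonneg (by linarith) _
          exact mul_le_mul (pow_le_pow_left₀ hk'.le hkn' 2) (mul_le_mul e4
            (one_sub_pow_le_exp hp1 _) h0 (Real.exp_pos _).le) (by positivity) (by positivity)
      _ = Real.exp (2 * Real.log n + (2 * m + -(p * (s * s : ℕ)))) := by
          rw [Real.exp_add, Real.exp_add, two_mul (Real.log _), Real.exp_add, hexpn, sq]
      _ ≤ 1 / n := by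
          rw [hinv]
          refine Real.exp_le_exp.2 ?_
          -- From `s ≥ m/10` and `p m ≥ 300` one gets `p s² ≥ 3m`, which beats the entropy `2m` by
          -- `m ≥ 12 log n`.
          have h1 : (m : ℝ) / 10 * (m / 10) ≤ s * s := by gcongr
          have h2 : (p : ℝ) * (m / 10 * (m / 10)) ≤ p * (s * s) := by gcongr
          have h3 : 300 * (m : ℝ) ≤ p * m * m := by gcongr
          push_cast
          linarith
  have T3 : (n : ℝ) * (1 - p) ^ (l * (m - 1 - s)) ≤ 1 / n := by
    calc (n : ℝ) * (1 - p) ^ (l * (m - 1 - s))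
        ≤ n * Real.exp (-(p * (l * (m - 1 - s) : ℕ))) := by
          gcongr
          exact one_sub_pow_le_exp hp1 _
      _ = Real.exp (Real.log n + -(p * (l * (m - 1 - s) : ℕ))) := by
          rw [Real.exp_add, hexpn]
      _ ≤ 1 / n := by
          rw [hinv]
          refine Real.exp_le_exp.2 ?_
          have h1 : (m : ℝ) ≤ 2 * (m - 1 - s : ℕ) := by exact_mod_cast hsm
          have h2 : (p : ℝ) * l * m ≤ p * l * (2 * (m - 1 - s : ℕ)) := by gcongr
          push_cast at h2 ⊢
          linarith
  have hE : ∀ q : ℝ, q ≤ 1 → ∀ j : ℕ, ENNReal.ofReal (1 - q) ^ j = ENNReal.ofReal ((1 - q) ^ j) :=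
    fun q hq j => (ENNReal.ofReal_pow (by linarith) j).symm
  have hnat : ∀ j : ℕ, (j : ℝ≥0∞) = ENNReal.ofReal j := fun j => (ENNReal.ofReal_natCast j).symm
  have h2 : (2 : ℝ≥0∞) ^ m = ENNReal.ofReal (2 ^ m) := by
    rw [ENNReal.ofReal_pow two_pos.le]; simp
  have h4 : (4 : ℝ≥0∞) ^ m = ENNReal.ofReal (4 ^ m) := by
    rw [ENNReal.ofReal_pow (by norm_num)]; simp
  have hp1' : 0 ≤ 1 - (p : ℝ) := by linarith
  have hk2 : (0 : ℝ) ≤ 1 - 1 / k / 2 := by linarith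
  rw [hE _ (by linarith), hE _ hp1, hE _ hp1, hnat k, hnat n, h2, h4,
    ← ENNReal.ofReal_pow (by positivity), ← ENNReal.ofReal_mul (by positivity),
    ← ENNReal.ofReal_mul (by positivity), ← ENNReal.ofReal_mul (by positivity),
    ← ENNReal.ofReal_mul (by positivity), ← ENNReal.ofReal_mul (by positivity),
    ← ENNReal.ofReal_add (by positivity) (by positivity),
    ← ENNReal.ofReal_add (by positivity) (by positivity)]
  refine ENNReal.ofReal_le_ofReal ?_
  have : (3 : ℝ) / n = 1 / n + (1 / n + 1 / n) := by ring
  rw [this]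
  exact add_le_add T1 (add_le_add T2 T3)

end UpperBound

/-! ### Choice of parameters and the limit in part (b) -/

section Asymptotics

open scoped ENNReal

theorem eventually_mul_log_pow_le (C : ℝ) (j : ℕ) :
    ∀ᶠ n : ℕ in atTop, C * Real.log n ^ j ≤ n := by
  have h := ((Real.isLittleO_pow_log_id_atTop (n := j)).const_mul_left C).bound one_pos
  filter_upwards [tendsto_natCast_atTop_atTop.eventually h] with n hn
  simpa using (le_abs_self _).trans hn

/-- With `h = ⌈log n⌉` fine subdivisions per side, about `log₂ n` steps inside a fine cell cost `O(d
/ b)`, comparable to crossing a coarse cell. -/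
theorem tendsto_law_compl_distortionLE (d : ℕ) (hd : 1 ≤ d) (ω : ℕ → ℝ)
    (hω : Tendsto ω atTop atTop) (p : ℕ → unitInterval)
    (hp : ∀ᶠ n : ℕ in atTop, ω n * Real.log n ^ d / n ≤ (p n : ℝ)) (b : ℕ) [NeZero b] :
    Tendsto (fun n => law d n (p n) (distortionLE d n (ENNReal.ofReal (12 * d / b)))ᶜ)
      atTop (𝓝 0) := by
  have hb : (0 : ℝ) < b := by exact_mod_cast NeZero.pos b
  have hlogt : Tendsto (fun n : ℕ => Real.log n) atTop atTop :=
    Real.tendsto_log_atTop.comp tendsto_natCast_atTop_atTop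
  have hlim : Tendsto (fun n : ℕ => ENNReal.ofReal (3 / n)) atTop (𝓝 0) := by
    rw [← ENNReal.ofReal_zero]
    exact ENNReal.tendsto_ofReal (tendsto_const_div_atTop_nhds_zero_nat 3)
  refine tendsto_of_tendsto_of_tendsto_of_le_of_le' tendsto_const_nhds hlim
    (Eventually.of_forall fun _ => zero_le) ?_
  -- As `k ≤ (2 b log n)^d` and `m ≥ n / (4k)`, the constant `1200` yields `p m ≥ 300` and the
  -- constant `48` yields `m ≥ 12 log n`.
  filter_upwards [hp, hω.eventually_ge_atTop (1200 * (2 * b) ^ d), hlogt.eventually_ge_atTop 20,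
    eventually_mul_log_pow_le (48 * (2 * b) ^ d) (d + 1), eventually_gt_atTop 0]
    with n hp hω hlog20 hnlog hn
  have hn' : (0 : ℝ) < n := by exact_mod_cast hn
  set ℓ := Real.log n with hℓ
  have hℓ0 : 0 < ℓ := by linarith
  set h : ℕ := ⌈ℓ⌉₊ with hh
  have hh0 : 0 < h := Nat.ceil_pos.2 hℓ0
  have : NeZero h := ⟨hh0.ne'⟩
  have hhℓ : ℓ ≤ h := Nat.le_ceil _
  have hh2 : (h : ℝ) ≤ 2 * ℓ := by
    have := Nat.ceil_lt_add_one hℓ0.le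
    linarith
  have hhpos : (0 : ℝ) < h := by exact_mod_cast hh0
  set k : ℕ := (b * h) ^ d with hk
  have hk0 : 0 < k := pow_pos (Nat.mul_pos (NeZero.pos b) hh0) d
  have hk0' : (0 : ℝ) < k := by exact_mod_cast hk0
  have hkle : (k : ℝ) ≤ (2 * b) ^ d * ℓ ^ d := by
    rw [hk, ← mul_pow]
    push_cast
    refine pow_le_pow_left₀ (by positivity) ?_ d
    nlinarith
  have hkℓ : 48 * k * ℓ ≤ n := by
    refine le_trans ?_ hnlog
    calc 48 * k * ℓ ≤ 48 * ((2 * b) ^ d * ℓ ^ d) * ℓ := by gcongr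
      _ = 48 * (2 * b) ^ d * ℓ ^ (d + 1) := by ring
  set m : ℕ := ⌊(n : ℝ) / (2 * k)⌋₊ with hm
  have hmle : (m : ℝ) ≤ n / (2 * k) := Nat.floor_le (by positivity)
  have hlem : (n : ℝ) / (4 * k) ≤ m := by
    have h1 := Nat.lt_floor_add_one ((n : ℝ) / (2 * k))
    have h2 : (n : ℝ) / (2 * k) = n / (4 * k) + n / (4 * k) := by field_simp; norm_num
    have h3 : 1 ≤ (n : ℝ) / (4 * k) := by
      rw [le_div_iff₀ (by positivity)]
      nlinarith
    linarith
  have hmlog : 12 * ℓ ≤ m := by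
    refine le_trans ?_ hlem
    rw [le_div_iff₀ (by positivity)]
    linarith
  have hm20 : 20 ≤ m := by
    have : (20 : ℝ) ≤ m := by linarith
    exact_mod_cast this
  set s : ℕ := (m - 1) / 5 with hs
  have hkn : k ≤ n := by
    have : (k : ℝ) ≤ n := by nlinarith
    exact_mod_cast this
  have hsn : s < 2 ^ (Nat.log 2 n + 1) := by
    have h1 : m ≤ n := by
      have : (m : ℝ) ≤ n := hmle.trans (div_le_self hn'.le (by
        have : (1 : ℝ) ≤ k := by exact_mod_cast hk0
        linarith))
      exact_mod_cast this
    have h2 := Nat.lt_pow_succ_log_self (one_lt_two) n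
    omega
  have hωpos : 0 ≤ ω n := le_trans (by positivity) hω
  have hpm' : ω n * ℓ ^ d / (4 * k) ≤ p n * m := by
    calc ω n * ℓ ^ d / (4 * k) = ω n * ℓ ^ d / n * (n / (4 * k)) := by field_simp
      _ ≤ p n * m := mul_le_mul hp hlem (by positivity) (p n).2.1
  have hpm : 300 ≤ (p n : ℝ) * m := by
    refine le_trans ?_ hpm'
    rw [le_div_iff₀ (by positivity)]
    calc 300 * (4 * (k : ℝ)) ≤ 300 * (4 * ((2 * b) ^ d * ℓ ^ d)) := by gcongr
      _ = 1200 * (2 * b) ^ d * ℓ ^ d := by ring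
      _ ≤ ω n * ℓ ^ d := by gcongr
  have hlpm : 4 * ℓ ≤ (h ^ d : ℕ) * (p n * m : ℝ) := by
    have h1 : (h : ℝ) ^ d * (ω n * ℓ ^ d / (4 * k)) = ω n * ℓ ^ d / (4 * b ^ d) := by
      rw [hk]
      push_cast
      rw [mul_pow]
      field_simp
    push_cast
    calc 4 * ℓ ≤ ω n * ℓ ^ d / (4 * b ^ d) := by
          rw [le_div_iff₀ (by positivity)]
          have h2 : ℓ ≤ ℓ ^ d := le_self_pow₀ (by linarith) (by omega)
          have h3 : (b : ℝ) ^ d ≤ (2 * b) ^ d := by gcongr; linarith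
          have h4 : 16 * (b : ℝ) ^ d ≤ ω n := by
            have : (0 : ℝ) ≤ (2 * b) ^ d := by positivity
            linarith
          calc 4 * ℓ * (4 * b ^ d) = 16 * b ^ d * ℓ := by ring
            _ ≤ ω n * ℓ ^ d := by gcongr
      _ = h ^ d * (ω n * ℓ ^ d / (4 * k)) := h1.symm
      _ ≤ _ := by gcongr
  have hms : (m : ℝ) / 10 ≤ s := by
    rw [div_le_iff₀ (by norm_num)]
    have : m ≤ s * 10 := by omega
    exact_mod_cast this
  have hmain := law_compl_distortionLE_le d n b h (p n) (s := s) (m := m) (t := Nat.log 2 n + 1)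
    (by omega) hsn
  refine le_trans (measure_mono ?_) (hmain.trans ?_)
  · refine Set.compl_subset_compl.2 fun x hx u v => (hx u v).trans ?_
    gcongr
    have hlog2 : (Nat.log 2 n : ℝ) ≤ 2 * h := by
      refine (Real.natLog_le_logb n 2).trans ?_
      rw [Real.logb, div_le_iff₀ (by positivity)]
      have := Real.log_two_gt_d9
      push_cast
      nlinarith
    have hcast : (2 * ((Nat.log 2 n + 1 : ℕ) : ℝ≥0∞) + 2) =
        ENNReal.ofReal (2 * ((Nat.log 2 n + 1 : ℕ) : ℝ) + 2) := by
      rw [ENNReal.ofReal_add (by positivity) (by positivity), ENNReal.ofReal_mul (by positivity),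
        ENNReal.ofReal_natCast]
      simp
    have h4 : (4 : ℝ≥0∞) = ENNReal.ofReal 4 := by simp
    rw [hcast, h4, ← ENNReal.ofReal_mul (by positivity), ← ENNReal.ofReal_mul (by positivity),
      ← ENNReal.ofReal_add (by positivity) (by positivity)]
    refine ENNReal.ofReal_le_ofReal ?_
    have h8 : 2 * ((Nat.log 2 n + 1 : ℕ) : ℝ) + 2 ≤ 8 * h := by
      have : (1 : ℝ) ≤ h := by exact_mod_cast hh0
      push_cast
      linarith
    -- Coarse moves contribute `4d/b` and steps in fine cells `8d/b`.
    calc 4 * (d * (1 / b)) + (2 * ((Nat.log 2 n + 1 : ℕ) : ℝ) + 2) * (d * (1 / (b * h)))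
        ≤ 4 * (d * (1 / (b : ℝ))) + 8 * h * (d * (1 / (b * h))) := by gcongr
      _ = 12 * d / b := by field_simp; norm_num
  · have := failure_le (p := p n) (l := h ^ d) hn hkn hk0 hmle hms (by omega) hmlog hpm hlpm
    exact this

/-- Convergence for every fixed threshold gives convergence for a vanishing threshold. -/
theorem exists_tendsto_zero_of_forall (a : ℕ → ℝ → ℝ≥0∞) (ha : ∀ n, Antitone (a n))
    (hone : ∀ n δ, a n δ ≤ 1) (h : ∀ δ > 0, Tendsto (fun n => a n δ) atTop (𝓝 0)) :
    ∃ ε : ℕ → ℝ, (∀ n, 0 < ε n) ∧ Tendsto ε atTop (𝓝 0) ∧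
      Tendsto (fun n => a n (ε n)) atTop (𝓝 0) := by
  let S : ℕ → Set ℝ := fun n => {δ | 0 < δ ∧ a n δ ≤ ENNReal.ofReal δ}
  have hne : ∀ n, (S n).Nonempty := fun n => ⟨1, one_pos, by simpa using hone n 1⟩
  have hbdd : ∀ n, BddBelow (S n) := fun n => ⟨0, fun δ hδ => hδ.1.le⟩
  have hnonneg : ∀ n, 0 ≤ sInf (S n) := fun n => le_csInf (hne n) fun δ hδ => hδ.1.le
  have hinf : Tendsto (fun n => sInf (S n)) atTop (𝓝 0) := by
    rw [Metric.tendsto_atTop']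
    intro δ hδ
    have hev : ∀ᶠ n in atTop, a n (δ / 2) ≤ ENNReal.ofReal (δ / 2) :=
      (h _ (half_pos hδ)).eventually_le_const (by simpa using hδ)
    obtain ⟨N, hN⟩ := eventually_atTop.1 hev
    refine ⟨N, fun n hn => ?_⟩
    rw [Real.dist_0_eq_abs, abs_of_nonneg (hnonneg n)]
    exact (csInf_le (hbdd n) ⟨half_pos hδ, hN n hn.le⟩).trans_lt (half_lt_self hδ)
  -- The infimum need not be attained; the added `1 / (n + 1)` puts an element of `S n` below the
  -- threshold, and antitonicity applies.
  have hε : Tendsto (fun n : ℕ => sInf (S n) + 1 / ((n : ℝ) + 1)) atTop (𝓝 0) := by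
    simpa using hinf.add tendsto_one_div_add_atTop_nhds_zero_nat
  have hpos : ∀ n : ℕ, (0 : ℝ) < 1 / ((n : ℝ) + 1) := fun n => by positivity
  refine ⟨_, fun n => add_pos_of_nonneg_of_pos (hnonneg n) (hpos n), hε, ?_⟩
  refine tendsto_of_tendsto_of_tendsto_of_le_of_le tendsto_const_nhds
    (by simpa only [ENNReal.ofReal_zero] using ENNReal.tendsto_ofReal hε) (fun _ => zero_le) fun n => ?_
  obtain ⟨δ, hδS, hδ⟩ := exists_lt_of_csInf_lt (hne n) (lt_add_of_pos_right _ (hpos n))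
  exact (ha n hδ.le).trans (hδS.2.trans (ENNReal.ofReal_le_ofReal hδ.le))

theorem distortionLE_subset {d n : ℕ} {δ : ℝ} (hδ : 0 ≤ δ) :
    distortionLE d n (ENNReal.ofReal δ) ⊆
      {x | ∀ u v : Fin n, graphDist x u v ≠ ⊤ ∧
        |(graphDist x u v).toReal - euclDist x u v| ≤ δ} := by
  intro x hx u v
  have hfin : edist (x.1 u) (x.1 v) + ENNReal.ofReal δ ≠ ⊤ := by simp [edist_ne_top]
  have hne : graphDist x u v ≠ ⊤ := ne_top_of_le_ne_top hfin (hx u v)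
  refine ⟨hne, ?_⟩
  have h1 := ENNReal.toReal_mono hne (edist_le_graphDist x u v)
  have h2 := ENNReal.toReal_mono hfin (hx u v)
  rw [ENNReal.toReal_add (edist_ne_top _ _) ENNReal.ofReal_ne_top, ENNReal.toReal_ofReal hδ] at h2
  rw [← dist_edist] at h1 h2
  rw [euclDist, abs_le]
  constructor <;> linarith

theorem exists_aas_graphDist_sub_le (d : ℕ) (hd : 1 ≤ d) (ω : ℕ → ℝ)
    (hω : Tendsto ω atTop atTop) (p : ℕ → unitInterval)
    (hp : ∀ᶠ n : ℕ in atTop, ω n * Real.log n ^ d / n ≤ (p n : ℝ)) :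
    ∃ ε : ℕ → ℝ, Tendsto ε atTop (𝓝 0) ∧
      AAS d p fun n => {x | ∀ u v : Fin n, graphDist x u v ≠ ⊤ ∧
        |(graphDist x u v).toReal - euclDist x u v| ≤ ε n} := by
  have hd' : (0 : ℝ) < d := by exact_mod_cast hd
  have hmono : ∀ n, Antitone fun δ : ℝ =>
      law d n (p n) (distortionLE d n (ENNReal.ofReal δ))ᶜ := by
    intro n δ δ' hδ
    refine measure_mono (Set.compl_subset_compl.2 fun x hx u v => (hx u v).trans ?_)
    gcongr
  obtain ⟨ε, hpos, hε, hlim⟩ := exists_tendsto_zero_of_forall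
    (fun n δ => law d n (p n) (distortionLE d n (ENNReal.ofReal δ))ᶜ) hmono
    (fun n δ => by
      have : IsProbabilityMeasure (law d n (p n)) := by unfold law; infer_instance
      exact prob_le_one)
    (fun δ hδ => by
      obtain ⟨b, hb⟩ := exists_nat_gt (12 * d / δ)
      have hb0 : (0 : ℝ) < b := lt_trans (by positivity) hb
      have : NeZero b := ⟨by rintro rfl; simp at hb0⟩
      refine tendsto_of_tendsto_of_tendsto_of_le_of_le tendsto_const_nhds
        (tendsto_law_compl_distortionLE d hd ω hω p hp b) (fun _ => zero_le)
        fun n => hmono n ?_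
      rw [div_lt_iff₀ hδ] at hb
      rw [div_le_iff₀ hb0]
      linarith)
  refine ⟨ε, hε, tendsto_of_tendsto_of_tendsto_of_le_of_le tendsto_const_nhds hlim
    (fun _ => zero_le) fun n => ?_⟩
  exact measure_mono (Set.compl_subset_compl.2 (distortionLE_subset (hpos n).le))

end Asymptotics

end EmbeddedRandomGraph

theorem theorem1 (d : ℕ) (hd : 1 ≤ d) (ω : ℕ → ℝ) (hω : Tendsto ω atTop atTop) :
    (∀ p : ℕ → unitInterval,
      (∀ᶠ n : ℕ in atTop, (p n : ℝ) ≤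
        1 / (ω n ^ d * Real.log (Real.log n) ^ (2 * d)) * (Real.log n ^ d / n)) →
      ∀ u v : ℕ → ℕ, (∀ᶠ n : ℕ in atTop, u n ≠ v n) →
        EmbeddedRandomGraph.AAS d p fun n =>
          {x | ∀ (hu : u n < n) (hv : v n < n),
            ENNReal.ofReal (ω n / (8 * d * Real.exp 1 ^ d)) ≤
              EmbeddedRandomGraph.graphDist x ⟨u n, hu⟩ ⟨v n, hv⟩}) ∧
    (∀ p : ℕ → unitInterval,
      (∀ᶠ n : ℕ in atTop, ω n * Real.log n ^ d / n ≤ (p n : ℝ)) →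
      ∃ ε : ℕ → ℝ, Tendsto ε atTop (𝓝 0) ∧
        EmbeddedRandomGraph.AAS d p fun n =>
          {x | ∀ u v : Fin n,
            EmbeddedRandomGraph.graphDist x u v ≠ ⊤ ∧
              |(EmbeddedRandomGraph.graphDist x u v).toReal -
                EmbeddedRandomGraph.euclDist x u v| ≤ ε n}) := 
  ⟨fun p hp u v huv => EmbeddedRandomGraph.aas_le_graphDist d hd ω hω p hp u v huv,
    fun p hp => EmbeddedRandomGraph.exists_aas_graphDist_sub_le d hd ω hω p hp⟩
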